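/- Let $q=|F|$ be a prime power, where $F=\mathbb F_q$ has characteristic $p$, and write $\omega=e^{2\pi i/p}$. For a finite field $E$ of characteristic $p$, with absolute trace $\mathrm{tr}:E\to\mathbb F_p$, and $a,b\in E^m$, let $X^aZ^b$ be the Pauli operator on $(\mathbb C^{|E|})^{\otimes m}$ given by $X^a|y\rangle=|y-a\rangle$, $Z^b|y\rangle=\omega^{\mathrm{tr}(b\cdot y)}|y\rangle$; Paulis are taken modulo phases, i.e. identified with their labels in $(E\times E)^m$, and the weight of a Pauli is its number of non-identity tensor factors. A stabilizer is a group $\mathcal S$ (modulo phases) of pairwise commuting Paulis; its normalizer $\mathcal N(\mathcal S)$ is the set of Paulis commuting with all of $\mathcal S$; the associated code is an $[[m,k]]_{|E|}$ code if $|\mathcal S|=|E|^{m-k}$, and its distance is the least weight in $\mathcal N(\mathcal S)\setminus\mathcal S$ (if $k=0$: the least weight in $\mathcal S\setminus\{I\}$). An $[[N,K,D]]$ code is quantum MDS if $D=(N-K)/2+1$; a classical code $C\subseteq A^N$ of minimum distance $D$ is MDS if $|C|=|A|^{N-D+1}$. An $[[n,n]]_q$ inner code is a tuple $\bar X_1,\dots,\bar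 X_n,\bar Z_1,\dots,\bar Z_n$ of Paulis on $n$ $q$-ary systems with $\bar X_i^{x}\bar Z_j^{z}=\omega^{\mathrm{tr}(xz\delta_{ij})}\bar Z_j^{z}\bar X_i^{x}$ for all $x,z\in\mathbb F_q$, all $\bar X_i^{x}$ commuting with one another and all $\bar Z_i^{z}$ commuting with one another (powers with exponent in $\mathbb F_q$ are scalar multiples of labels). Let $N=q^n$ and let $b_1,\dots,b_n$ be a basis of $\mathbb F_N$ over $\mathbb F_q$. Given a stabilizer $\mathcal S$ on $N$ systems over $\mathbb F_N$ and inner codes $C_1,\dots,C_N$, the concatenated code (block length $nN$, alphabet size $q$) has as stabilizer the set of images of the elements of $\mathcal S$ under the map that replaces the $j$-th factor $X^aZ^c$ by $\prod_i \bar X_i^{a_i}\prod_i\bar Z_i^{c_i}$ with the operators of $C_j$, where $a=\sum_i a_ib_i$ and $c_i=\mathrm{Tr}_{\mathbb F_N/\mathbb F_q}(c\,b_i)$. Let $H_{Q}(x)=x\log_Q(Q-1)-x\log_Q x-(1-x)\log_Q(1-x)$, let $H_Q^{-1}:[0,1]\to[0,1-1/Q]$ be the inverse of its restriction to $[0,1-1/Q]$,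 and let $$\bar f(q)=\frac{\log_q 2}{\log_{q^2}\left[(q^2-1)\left(\frac{2}{H_{q^2}^{-1}(1/2)}-1\right)\right]}.$$ Theorem 2. (a) Let $n\ge 2$, $N=q^n$, and let $R\in[0,1]$ be such that $K=NR$ is an integer and $NR-q$ is even. Then there are $[[N,NR]]_N$ quantum MDS stabilizer codes whose normalizer, as a code over the alphabet $\mathbb F_N\times\mathbb F_N$ of size $N^2$, is classical MDS; for instance, for every enumeration $\alpha_1,\dots,\alpha_N$ of $\mathbb F_N$, the code whose stabilizer consists of the Paulis with both $X$-part and $Z$-part of the form $(g(\alpha_1),\dots,g(\alpha_N))$, $g\in\mathbb F_N[x]$, $\deg g<(N-K)/2$ (with independent choices of $g$ for the two parts). For every such outer code, concatenation with any $N$ inner $[[n,n]]_q$ codes gives an $[[nN,nNR]]_q$ stabilizer code; and if the $N$ inner codes are chosen independently and uniformly at random, then with probability at least $1-q^{\,n-(1-R)q^n\bar f(q)}$ the distance $d$ of the concatenated code satisfies $$\frac{d}{nN}\ \ge\ H_{q^2}^{-1}\left(\frac{1-R}{2}\right)-\frac{4\bar f(q)}{n(1-R)}$$ (for $R=1$ the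 last fraction is read as $0$, and the bound says only $d\ge 0$). (b) Consequently the codes attain the quantum Gilbert–Varshamov bound asymptotically almost surely: for all $R\in[0,1]$, $\varepsilon>0$ and $\eta>0$ there are $\delta>0$ and $n_0$ such that for all $n\ge n_0$, all integers $0\le K\le N=q^n$ with $K-q$ even and $|K/N-R|<\delta$, and every $[[N,K]]_N$ outer code as in (a), the concatenated code satisfies $\frac{d}{nN}\ge H_{q^2}^{-1}\left(\frac{1-R}{2}\right)-\varepsilon$ with probability at least $1-\eta$. -/

import Mathlib

noncomputable section

namespace QConcat

/-! ### Entropy -/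

/-- The `Q`-ary entropy function with logarithms to base `Q`:
`H_Q(x) = x log_Q (Q-1) - x log_Q x - (1-x) log_Q (1-x)`. -/
def entropy (Q : ℕ) (x : ℝ) : ℝ := Real.qaryEntropy Q x / Real.log Q

/-- The inverse `H_Q⁻¹ : [0,1] → [0,1-1/Q]` of the restriction of `H_Q` to `[0,1-1/Q]`. -/
def entropyInv (Q : ℕ) (y : ℝ) : ℝ :=
  Function.invFunOn (entropy Q) (Set.Icc 0 (1 - 1 / (Q : ℝ))) y

/-- The constant `f̄(q)`. -/
def fbar (q : ℕ) : ℝ :=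
  Real.logb q 2 /
    Real.logb ((q : ℝ) ^ 2)
      (((q : ℝ) ^ 2 - 1) * (2 / entropyInv (q ^ 2) (1 / 2) - 1))

/-! ### Paulis over a finite field of characteristic `p` -/

section Pauli

variable (p : ℕ) [Fact p.Prime] {F : Type*} [Field F] [Fintype F] [Algebra (ZMod p) F]
variable {ι : Type*} [Fintype ι]

/-- The phase `ω^{tr x}`, where `ω = e^{2πi/p}` and `tr` is the trace of `F` over its prime field.
If `F = ZMod p` then `phase p 1 = e^{2πi/p}`. -/
def phase (x : F) : ℂ := ZMod.stdAddChar (Algebra.trace (ZMod p) F x)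

/-- The set of Paulis modulo phases on `ι`-many systems of dimension `|F|`. The label
`u` with `u i = (aᵢ, bᵢ)` stands for `⨂ᵢ X^{aᵢ} Z^{bᵢ}`. Multiplication modulo phases
is addition of labels, and the power with exponent `c : F` is the scalar multiple `c • u`. -/
abbrev Pauli (F : Type*) (ι : Type*) := ι → F × F

/-- The space `(ℂ^{|F|})^{⊗ ι}`, with computational basis `|y⟩`, `y : ι → F`. -/
abbrev Space (F : Type*) (ι : Type*) := (ι → F) → ℂ

/-- `X^a |y⟩ = |y - a⟩`. -/
def opX (a : ι → F) : Module.End ℂ (Space F ι) where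
  toFun f y := f (y + a)
  map_add' _ _ := rfl
  map_smul' _ _ := rfl

/-- `Z^b |y⟩ = ω^{tr (b · y)} |y⟩`. -/
def opZ (b : ι → F) : Module.End ℂ (Space F ι) where
  toFun f y := phase p (∑ i, b i * y i) * f y
  map_add' f g := by funext y; simp [mul_add]
  map_smul' c f := by funext y; simp [mul_left_comm]

/-- The operator `⨂ᵢ X^{aᵢ} Z^{bᵢ}` of a Pauli label. -/
def pauliOp (u : Pauli F ι) : Module.End ℂ (Space F ι) :=
  opX (fun i => (u i).1) * opZ p (fun i => (u i).2)

/-- The `ω`-commutator `[A,B]_ω = A B - ω B A`. -/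
def omegaCommutator {V : Type*} [AddCommGroup V] [Module ℂ V] (ω : ℂ)
    (A B : Module.End ℂ V) : Module.End ℂ V :=
  A * B - ω • (B * A)

/-- `S` is a stabilizer of dimension `m`: a group of pairwise commuting Paulis of size `|F|^m`. -/
def IsStabilizer (S : Set (Pauli F ι)) (m : ℕ) : Prop :=
  (∃ G : AddSubgroup (Pauli F ι), (G : Set (Pauli F ι)) = S) ∧
  (∀ x ∈ S, ∀ y ∈ S, pauliOp p x * pauliOp p y = pauliOp p y * pauliOp p x) ∧
  S.ncard = Fintype.card F ^ m

/-- The normalizer (which is the centralizer) of `S`. -/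
def normalizer (S : Set (Pauli F ι)) : Set (Pauli F ι) :=
  {x | ∀ y ∈ S, pauliOp p x * pauliOp p y = pauliOp p y * pauliOp p x}

/-- The weight of a Pauli: the number of systems on which it is not the identity. -/
def weight (u : Pauli F ι) : ℕ := {i | u i ≠ 0}.ncard

open scoped Classical in
/-- The distance of the stabilizer code with stabilizer `S`: the least weight of an element of
`N(S) \ S`. If `N(S) = S` (no encoded system) it is, by the usual convention, the least weight of
a nontrivial element of `S`. -/
def distance (S : Set (Pauli F ι)) : ℕ :=
  if normalizer p S = S then sInf (weight '' (S \ {0})) else sInf (weight '' (normalizer p S \ S))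

end Pauli

/-! ### MDS codes -/

section MDS

open scoped Classical in
/-- The minimum distance of a classical block code over the alphabet `A`. -/
def minDist {ι A : Type*} [Fintype ι] (C : Set (ι → A)) : ℕ :=
  sInf {d | ∃ x ∈ C, ∃ y ∈ C, x ≠ y ∧ d = hammingDist x y}

/-- A classical MDS code: its size and its minimum distance `D` satisfy `|C| = |A|^{n-D+1}`. -/
def IsClassicalMDS {ι A : Type*} [Fintype ι] [Fintype A] (C : Set (ι → A)) : Prop :=
  C.ncard = Fintype.card A ^ (Fintype.card ι + 1 - minDist C)

/-- `S` is the stabilizer of an `[[N, K, D]]` quantum MDS code over an alphabet of size `|L|`,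
`N = |ι|`, `D = (N - K)/2 + 1`, whose normalizer is a classical MDS code over the alphabet
`L × L` of size `|L|²`. -/
def IsQuantumMDS (p : ℕ) [Fact p.Prime] {L : Type*} [Field L] [Fintype L] [Algebra (ZMod p) L]
    {ι : Type*} [Fintype ι] (S : Set (Pauli L ι)) (K : ℕ) : Prop :=
  IsStabilizer p S (Fintype.card ι - K) ∧
  2 * distance p S + K = Fintype.card ι + 2 ∧
  IsClassicalMDS (normalizer p S)

/-- The stabilizer of the quantum Reed-Solomon code with locators `α` and parameter `k`: the
Paulis whose `X`-part and `Z`-part are both evaluation vectors of polynomials of degree `< k`. -/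
def rsStabilizer {L : Type*} [Field L] {ι : Type*} (α : ι → L) (k : ℕ) : Set (Pauli L ι) :=
  {u | ∃ f ∈ Polynomial.degreeLT L k, ∃ g ∈ Polynomial.degreeLT L k,
    ∀ j, u j = (f.eval (α j), g.eval (α j))}

end MDS

/-! ### Rate-one inner codes and concatenation -/

section Concat

variable (p : ℕ) [Fact p.Prime] (F : Type*) [Field F] [Fintype F] [Algebra (ZMod p) F] (n : ℕ)

/-- An `[[n,n]]_q` stabilizer code. Its stabilizer has size `q^0`, hence is `{I}`, and its cosets
are singletons, so the code is the tuple of logical operators `X̄₁,…,X̄ₙ,Z̄₁,…,Z̄ₙ`, satisfying the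
commutation relations of the `X` and `Z` operators of `n` systems:
`[X̄ᵢ^x, Z̄ⱼ^z]_ω = 0` for the phase `ω = ω^{tr (x z δᵢⱼ)}`, and the `X̄ᵢ` commute with each other,
as do the `Z̄ᵢ`. If `|F|` is prime it suffices to demand this for `x = z = 1`. -/
structure InnerCode where
  X : Fin n → Pauli F (Fin n)
  Z : Fin n → Pauli F (Fin n)
  comm_XZ : ∀ i j, ∀ x z : F,
    omegaCommutator (phase p (if i = j then x * z else 0))
      (pauliOp p (x • X i)) (pauliOp p (z • Z j)) = 0
  comm_XX : ∀ i j, ∀ x z : F,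
    omegaCommutator 1 (pauliOp p (x • X i)) (pauliOp p (z • X j)) = 0
  comm_ZZ : ∀ i j, ∀ x z : F,
    omegaCommutator 1 (pauliOp p (x • Z i)) (pauliOp p (z • Z j)) = 0

instance : MeasurableSpace (InnerCode p F n) := ⊤

/-- The law of `M` independent, uniformly random `[[n,n]]_q` stabilizer codes. -/
def innerLaw (M : ℕ) : MeasureTheory.Measure (Fin M → InnerCode p F n) :=
  MeasureTheory.Measure.pi fun _ => ProbabilityTheory.uniformOn Set.univ

variable {p F n}

/-- The unique element `X̄₁^{x₁}⋯X̄ₙ^{xₙ} Z̄₁^{z₁}⋯Z̄ₙ^{zₙ}` of the coset with label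
`c = (xᵢ, zᵢ)ᵢ`. -/
def InnerCode.coset (C : InnerCode p F n) (c : Fin n → F × F) : Pauli F (Fin n) :=
  ∑ i, (c i).1 • C.X i + ∑ i, (c i).2 • C.Z i

/-- The identification of Paulis `X^a Z^z` on one system of dimension `|L| = q^n` with Paulis on
`n` systems of dimension `q`, given by the basis `b` of `L` over `F`: coordinates of `a` in the
basis `b`, and coordinates of `z` in the trace-dual basis, so that
`Tr (a z') = ∑ i, aᵢ z'ᵢ`. -/
def blockLabel {L : Type*} [Field L] [Algebra F L] (b : Module.Basis (Fin n) F L) (u : L × L) :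
    Fin n → F × F :=
  fun i => (b.repr u.1 i, Algebra.trace F L (u.2 * b i))

/-- The encoding of a Pauli on the `M` outer systems, the `j`-th block through the `j`-th inner
code. -/
def encode {L : Type*} [Field L] [Algebra F L] (b : Module.Basis (Fin n) F L) {M : ℕ}
    (C : Fin M → InnerCode p F n) (u : Pauli L (Fin M)) : Pauli F (Fin M × Fin n) :=
  fun ji => (C ji.1).coset (blockLabel b (u ji.1)) ji.2

/-- The stabilizer of the concatenated code. The inner stabilizers are trivial, so it consists of
the encoded elements of the outer stabilizer. -/
def concatStabilizer {L : Type*} [Field L] [Algebra F L] (b : Module.Basis (Fin n) F L) {M : ℕ}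
    (S : Set (Pauli L (Fin M))) (C : Fin M → InnerCode p F n) : Set (Pauli F (Fin M × Fin n)) :=
  encode b C '' S

end Concat

end QConcat

end

open QConcat

/-! The proof is a first-moment argument. Up to phases, Paulis commute according to a symplectic
form, and an inner code amounts to a symplectic automorphism of the labels. The symplectic group is
transitive on nonzero vectors (`exists_symplectic_apply_eq`), so a uniformly random inner code sends
a fixed nonzero label to each nonzero Pauli with the same probability `1/(q^(2n) - 1)`.

Fix a Pauli `v` on all `nN` systems, and let `W` be the set of blocks on which it is nontrivial.
Encoding preserves triviality of blocks, so only outer codewords with support exactly `W` can be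
sent to `v`, each with probability at most `(q^(2n) - 1)^(-|W|)` by independence. The MDS property
leaves at most `(q^(2n) - 1)^(|W| - e)` such codewords, where `e = D - 1 = (N - K)/2`. Hence `v` is
hit with probability at most `(q^(2n) - 1)^(-e)`, whatever `W` is (`innerLaw_exists_encode_eq_le`).
Summing over a Hamming ball of relative radius `x`, which has at most `q^(2nN H(x))` elements,
bounds the failure probability by `2 q^(2nN (H(x) - (1 - K/N)/2))` (`innerLaw_distance_lt_le`).

Part (a) follows because concavity gives `H` slope at least `1/2` wherever it is at most `1/2`; of
`fbar q` only nonnegativity is needed. Part (b) follows from strict monotonicity of `H`. The outer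
codes exist because the evaluation codes of degrees `< k` and `< N - k` on the whole field are dual
to each other. -/

noncomputable section

namespace QConcat

/-! ### The symplectic form and commutation of Paulis -/

section Symplectic

variable {F : Type*} [Field F] {ι : Type*} [Fintype ι]

/-- The symplectic form on Pauli labels, `⟨(a, b), (c, d)⟩ = a · d - b · c`. -/
def sympForm (F : Type*) [Field F] (ι : Type*) [Fintype ι] :
    LinearMap.BilinForm F (Pauli F ι) :=
  LinearMap.mk₂ F (fun u v => ∑ i, ((u i).1 * (v i).2 - (u i).2 * (v i).1))
    (fun u u' v => by
      rw [← Finset.sum_add_distrib]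
      exact Finset.sum_congr rfl fun i _ => by simp; ring)
    (fun c u v => by
      rw [smul_eq_mul, Finset.mul_sum]
      exact Finset.sum_congr rfl fun i _ => by simp; ring)
    (fun u v v' => by
      rw [← Finset.sum_add_distrib]
      exact Finset.sum_congr rfl fun i _ => by simp; ring)
    (fun c u v => by
      rw [smul_eq_mul, Finset.mul_sum]
      exact Finset.sum_congr rfl fun i _ => by simp; ring)

theorem sympForm_apply (u v : Pauli F ι) :
    sympForm F ι u v = ∑ i, ((u i).1 * (v i).2 - (u i).2 * (v i).1) := rfl

theorem sympForm_self (u : Pauli F ι) : sympForm F ι u u = 0 := by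
  rw [sympForm_apply]
  exact Finset.sum_eq_zero fun i _ => by ring

theorem sympForm_swap (u v : Pauli F ι) : sympForm F ι u v = -sympForm F ι v u := by
  rw [sympForm_apply, sympForm_apply, ← Finset.sum_neg_distrib]
  exact Finset.sum_congr rfl fun i _ => by ring

theorem sympForm_single_left [DecidableEq ι] (i : ι) (c : F × F) (v : Pauli F ι) :
    sympForm F ι (Pi.single i c) v = c.1 * (v i).2 - c.2 * (v i).1 := by
  rw [sympForm_apply, Finset.sum_eq_single i]
  · simp
  · intro j _ hj
    simp [Pi.single_eq_of_ne hj]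
  · simp

theorem eq_zero_of_sympForm_eq_zero {u : Pauli F ι} (h : ∀ v, sympForm F ι u v = 0) : u = 0 := by
  classical
  funext i
  have h1 := h (Pi.single i (1, 0))
  have h2 := h (Pi.single i (0, 1))
  rw [sympForm_swap, sympForm_single_left] at h1 h2
  ext
  · simpa using h2
  · simpa using h1

theorem exists_sympForm_ne_zero {u : Pauli F ι} (hu : u ≠ 0) : ∃ v, sympForm F ι u v ≠ 0 := by
  by_contra! h
  exact hu (eq_zero_of_sympForm_eq_zero h)

variable (p : ℕ) [Fact p.Prime] [Algebra (ZMod p) F]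

theorem phase_add (x y : F) : phase p (x + y) = phase p x * phase p y := by
  simp [phase, AddChar.map_add_eq_mul]

theorem phase_zero : phase p (0 : F) = 1 := by
  simp [phase]

theorem phase_ne_zero (x : F) : phase p x ≠ 0 := by
  intro h
  have := phase_add p x (-x)
  rw [h, add_neg_cancel, phase_zero] at this
  simp at this

theorem phase_eq_phase_iff {E : Type*} [Field E] [Algebra (ZMod p) E] (x : F) (y : E) :
    phase p x = phase p y ↔ Algebra.trace (ZMod p) F x = Algebra.trace (ZMod p) E y :=
  ZMod.injective_stdAddChar.eq_iff

theorem phase_eq_one_iff (x : F) : phase p x = 1 ↔ Algebra.trace (ZMod p) F x = 0 := by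
  rw [← phase_zero p (F := F), phase_eq_phase_iff, map_zero]

theorem pauliOp_apply (u : Pauli F ι) (f : Space F ι) (y : ι → F) :
    pauliOp p u f y =
      phase p (∑ i, (u i).2 * (y i + (u i).1)) * f (fun i => y i + (u i).1) := rfl

theorem pauliOp_mul_comm (u v : Pauli F ι) :
    pauliOp p u * pauliOp p v = phase p (sympForm F ι u v) • (pauliOp p v * pauliOp p u) := by
  ext f y
  simp only [Module.End.mul_apply, LinearMap.smul_apply, Pi.smul_apply, smul_eq_mul,
    pauliOp_apply, ← mul_assoc, ← phase_add]
  congr 1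
  · congr 1
    rw [sympForm_apply, ← Finset.sum_add_distrib, ← Finset.sum_add_distrib,
      ← Finset.sum_add_distrib]
    exact Finset.sum_congr rfl fun i _ => by ring
  · congr 1
    funext i
    ring

theorem pauliOp_mul_ne_zero (u v : Pauli F ι) : pauliOp p u * pauliOp p v ≠ 0 := by
  intro h
  have := congrFun (LinearMap.congr_fun h (fun _ => 1)) 0
  simp [Module.End.mul_apply, pauliOp_apply, phase_ne_zero] at this

/-- Exchanging two Paulis costs only a phase, and their product is never zero, so an operator
identity becomes an equation between phases. -/
theorem omegaCommutator_eq_zero_iff (c : ℂ) (u v : Pauli F ι) :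
    omegaCommutator c (pauliOp p u) (pauliOp p v) = 0 ↔ c = phase p (sympForm F ι u v) := by
  have h : omegaCommutator c (pauliOp p u) (pauliOp p v) =
      (phase p (sympForm F ι u v) - c) • (pauliOp p v * pauliOp p u) := by
    rw [omegaCommutator, pauliOp_mul_comm]
    exact (sub_smul _ _ _).symm
  rw [h, smul_eq_zero_iff_left (pauliOp_mul_ne_zero p v u), sub_eq_zero, eq_comm]

theorem pauliOp_commute_iff (u v : Pauli F ι) :
    pauliOp p u * pauliOp p v = pauliOp p v * pauliOp p u ↔
      Algebra.trace (ZMod p) F (sympForm F ι u v) = 0 := by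
  rw [← phase_eq_one_iff, eq_comm (a := phase p _), ← omegaCommutator_eq_zero_iff,
    omegaCommutator, one_smul, sub_eq_zero]

theorem mem_normalizer_iff {S : Set (Pauli F ι)} {u : Pauli F ι} :
    u ∈ normalizer p S ↔ ∀ v ∈ S, Algebra.trace (ZMod p) F (sympForm F ι u v) = 0 :=
  forall₂_congr fun v _ => pauliOp_commute_iff p u v

/-- The `𝔽_p`-valued commutation form on Pauli labels. -/
def traceSympForm (ι : Type*) [Fintype ι] : LinearMap.BilinForm (ZMod p) (Pauli F ι) :=
  LinearMap.mk₂ (ZMod p) (fun u v => Algebra.trace (ZMod p) F (sympForm F ι u v))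
    (fun u u' v => by simp)
    (fun c u v => by
      rw [← algebraMap_smul F c u, map_smul, LinearMap.smul_apply, algebraMap_smul, map_smul])
    (fun u v v' => by simp)
    (fun c u v => by rw [← algebraMap_smul F c v, map_smul, algebraMap_smul, map_smul])

theorem traceSympForm_apply (u v : Pauli F ι) :
    traceSympForm p ι u v = Algebra.trace (ZMod p) F (sympForm F ι u v) := rfl

theorem traceSympForm_isRefl : (traceSympForm p ι (F := F)).IsRefl := by
  intro u v h
  rw [traceSympForm_apply] at h ⊢
  rw [sympForm_swap, map_neg, h, neg_zero]

variable [Fintype F]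

theorem eq_zero_of_trace_mul_eq_zero {x : F}
    (h : ∀ c : F, Algebra.trace (ZMod p) F (c * x) = 0) : x = 0 :=
  (traceForm_nondegenerate (ZMod p) F).2 x h

/-- Replacing `v` by `c • v` for all `c` recovers the `F`-valued form from its trace. -/
theorem eq_zero_of_trace_sympForm_eq_zero {u : Pauli F ι}
    (h : ∀ v, Algebra.trace (ZMod p) F (sympForm F ι u v) = 0) : u = 0 :=
  eq_zero_of_sympForm_eq_zero fun v => eq_zero_of_trace_mul_eq_zero p fun c => by
    have := h (c • v)
    rwa [map_smul, smul_eq_mul] at this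

theorem traceSympForm_nondegenerate : (traceSympForm p ι (F := F)).Nondegenerate := by
  refine (LinearMap.IsRefl.nondegenerate_iff_separatingLeft
    (B := traceSympForm p ι (F := F)) fun u v => traceSympForm_isRefl p u v).2 ?_
  exact fun u h => eq_zero_of_trace_sympForm_eq_zero p h

theorem natCard_pauli (F : Type*) [Fintype F] (ι : Type*) [Fintype ι] :
    Nat.card (Pauli F ι) = Fintype.card F ^ (2 * Fintype.card ι) := by
  rw [Nat.card_fun, Nat.card_prod, Nat.card_eq_fintype_card, Nat.card_eq_fintype_card, pow_mul, sq]

/-- A stabilizer need not be `F`-linear, but every additive subgroup is a subspace over the prime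
field. There the normalizer is the orthogonal complement for a nondegenerate form, so the dimensions
add up. -/
theorem ncard_mul_ncard_normalizer (G : AddSubgroup (Pauli F ι)) :
    (G : Set (Pauli F ι)).ncard * (normalizer p (G : Set (Pauli F ι))).ncard =
      Fintype.card F ^ (2 * Fintype.card ι) := by
  set W := AddSubgroup.toZModSubmodule p G
  have hN : normalizer p (G : Set (Pauli F ι)) = ((traceSympForm p ι).orthogonal W : Set _) := by
    ext u
    rw [mem_normalizer_iff, SetLike.mem_coe, LinearMap.BilinForm.mem_orthogonal_iff]
    refine forall₂_congr fun v _ => ?_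
    rw [traceSympForm_apply, sympForm_swap, map_neg, neg_eq_zero]
  have hG : (G : Set (Pauli F ι)) = (W : Set _) := rfl
  have hc : ∀ U : Submodule (ZMod p) (Pauli F ι),
      (U : Set (Pauli F ι)).ncard = p ^ Module.finrank (ZMod p) U := by
    intro U
    have := Module.natCard_eq_pow_finrank (K := ZMod p) (V := U)
    rw [Nat.card_zmod] at this
    rw [← this]
    rfl
  have hV : p ^ Module.finrank (ZMod p) (Pauli F ι) = Fintype.card F ^ (2 * Fintype.card ι) := by
    have := Module.natCard_eq_pow_finrank (K := ZMod p) (V := Pauli F ι)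
    rw [Nat.card_zmod] at this
    rw [← this]
    rw [natCard_pauli]
  rw [hN, hG, hc, hc, ← pow_add, ← hV,
    LinearMap.BilinForm.finrank_orthogonal (traceSympForm_nondegenerate p),
    Nat.add_sub_cancel' (Submodule.finrank_le W)]

end Symplectic

/-! ### Quantum Reed-Solomon codes -/

section ReedSolomon

open Polynomial

theorem weight_add_ncard_zeros {F ι : Type*} [Field F] [Fintype ι] (u : Pauli F ι) :
    weight u + {i | u i = 0}.ncard = Fintype.card ι := by
  have h := Set.ncard_add_ncard_compl {i | u i ≠ 0}
  rw [Nat.card_eq_fintype_card] at h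
  rw [← h, weight]
  congr 2
  ext i
  simp

theorem hammingDist_eq_weight_sub {F ι : Type*} [Field F] [Fintype ι] {_ : DecidableEq (F × F)}
    (x y : Pauli F ι) : hammingDist x y = weight (x - y) := by
  rw [hammingDist, weight, ← Set.ncard_coe_finset]
  congr 1
  ext i
  simp [sub_eq_zero]

theorem eq_of_eval_eq_of_degree_lt_card {L : Type*} [Field L] [Fintype L] {f g : L[X]}
    (hf : f.degree < Fintype.card L) (hg : g.degree < Fintype.card L)
    (h : ∀ x, f.eval x = g.eval x) : f = g :=
  Polynomial.eq_of_degrees_lt_of_eval_finset_eq Finset.univ (by simpa using hf)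
    (by simpa using hg) fun x _ => h x

theorem sum_eval_eq_zero {L : Type*} [Field L] [Fintype L] {h : L[X]}
    (hh : h.natDegree < Fintype.card L - 1) : ∑ x, h.eval x = 0 := by
  simp_rw [Polynomial.eval_eq_sum_range]
  rw [Finset.sum_comm]
  refine Finset.sum_eq_zero fun i hi => ?_
  rw [← Finset.mul_sum, FiniteField.sum_pow_lt_card_sub_one, mul_zero]
  have := Finset.mem_range.1 hi
  omega

variable {L : Type*} [Field L] {ι : Type*}

/-- The evaluation map whose image is the Reed-Solomon stabilizer. -/
def rsEval (α : ι → L) (k : ℕ) : (degreeLT L k × degreeLT L k) →+ Pauli L ι where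
  toFun fg j := ((fg.1 : L[X]).eval (α j), (fg.2 : L[X]).eval (α j))
  map_zero' := by ext <;> simp
  map_add' _ _ := by ext <;> simp

theorem rsStabilizer_eq_range (α : ι → L) (k : ℕ) :
    rsStabilizer α k = ((rsEval α k).range : Set (Pauli L ι)) := by
  ext u
  constructor
  · rintro ⟨f, hf, g, hg, h⟩
    exact ⟨(⟨f, hf⟩, ⟨g, hg⟩), funext fun j => (h j).symm⟩
  · rintro ⟨⟨f, g⟩, rfl⟩
    exact ⟨f, f.2, g, g.2, fun j => rfl⟩

theorem zero_mem_rsStabilizer (α : ι → L) (k : ℕ) : 0 ∈ rsStabilizer α k := by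
  rw [rsStabilizer_eq_range]
  exact (rsEval α k).range.zero_mem

theorem sub_mem_rsStabilizer (α : ι → L) (k : ℕ) {x y : Pauli L ι} (hx : x ∈ rsStabilizer α k)
    (hy : y ∈ rsStabilizer α k) : x - y ∈ rsStabilizer α k := by
  rw [rsStabilizer_eq_range] at *
  exact (rsEval α k).range.sub_mem hx hy

theorem ncard_rsStabilizer [Fintype L] (α : ι ≃ L) {k : ℕ} (hk : k ≤ Fintype.card L) :
    (rsStabilizer α k).ncard = Fintype.card L ^ (2 * k) := by
  have hlt : ∀ f : degreeLT L k, (f : L[X]).degree < Fintype.card L := fun f =>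
    (mem_degreeLT.1 f.2).trans_le (by exact_mod_cast hk)
  have hinj : Function.Injective (rsEval α k) := by
    rintro ⟨f, g⟩ ⟨f', g'⟩ h
    have h' := fun x => congrFun h (α.symm x)
    simp only [rsEval, AddMonoidHom.coe_mk, ZeroHom.coe_mk, Equiv.apply_symm_apply,
      Prod.mk.injEq] at h'
    rw [Prod.mk.injEq]
    exact ⟨Subtype.ext (eq_of_eval_eq_of_degree_lt_card (hlt f) (hlt f') fun x => (h' x).1),
      Subtype.ext (eq_of_eval_eq_of_degree_lt_card (hlt g) (hlt g') fun x => (h' x).2)⟩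
  have hr : ((rsEval α k).range : Set (Pauli L ι)) = Set.range (rsEval α k) := rfl
  rw [rsStabilizer_eq_range, hr, ← Set.image_univ, Set.ncard_image_of_injective _ hinj,
    Set.ncard_univ, Nat.card_prod, Nat.card_congr (degreeLTEquiv L k).toEquiv, Nat.card_fun,
    Nat.card_eq_fintype_card, Nat.card_eq_fintype_card, Fintype.card_fin, two_mul, pow_add]

theorem ncard_roots_lt (α : ι ≃ L) {m : ℕ} {f : L[X]} (hf : f ∈ degreeLT L m) (hf0 : f ≠ 0)
    {s : Set ι} (hs : ∀ i ∈ s, f.eval (α i) = 0) : s.ncard < m := by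
  classical
  have h1 : s.ncard ≤ f.roots.toFinset.card := by
    rw [← Set.ncard_coe_finset, ← Set.ncard_image_of_injective s α.injective]
    refine Set.ncard_le_ncard ?_ (Finset.finite_toSet _)
    rintro _ ⟨i, hi, rfl⟩
    simpa [hf0] using hs i hi
  have h2 := (Multiset.toFinset_card_le f.roots).trans (card_roots' f)
  have h3 := (natDegree_lt_iff_degree_lt hf0).2 (mem_degreeLT.1 hf)
  omega

variable [Fintype ι]

/-- A trivial position is a common root of both polynomials, and one of them is nonzero, hence has
fewer than `m` roots. -/
theorem card_lt_weight_add (α : ι ≃ L) {m : ℕ} {u : Pauli L ι} (hu : u ∈ rsStabilizer α m)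
    (hu0 : u ≠ 0) : Fintype.card ι < weight u + m := by
  obtain ⟨f, hf, g, hg, h⟩ := hu
  have hz := weight_add_ncard_zeros u
  have key : {i | u i = 0}.ncard < m := by
    by_cases hf0 : f = 0
    · have hg0 : g ≠ 0 := by
        rintro rfl
        exact hu0 (funext fun j => by simp [h, hf0])
      exact ncard_roots_lt α hg hg0 fun i hi => by
        have := h i
        rw [hi.out] at this
        exact (congrArg Prod.snd this).symm
    · exact ncard_roots_lt α hf hf0 fun i hi => by
        have := h i
        rw [hi.out] at this
        exact (congrArg Prod.fst this).symm
  omega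

variable [Fintype L]

/-- The witness is a monic product of `m - 1` linear factors at locators. Its degree is exactly `m -
1`, which keeps it out of all smaller codes; this makes it usable for a distance measured on `N(S) \
S`. -/
theorem exists_mem_rsStabilizer_weight_le (α : ι ≃ L) {m : ℕ} (hm : 0 < m)
    (hmN : m ≤ Fintype.card ι) :
    ∃ u ∈ rsStabilizer α m, u ≠ 0 ∧ weight u + m ≤ Fintype.card ι + 1 ∧
      ∀ k < m, u ∉ rsStabilizer α k := by
  classical
  have hcard : Fintype.card ι = Fintype.card L := Fintype.card_congr α
  obtain ⟨T, -, hT⟩ := Finset.exists_subset_card_eq (s := (Finset.univ : Finset ι)) (n := m - 1)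
    (by simp; omega)
  set f : L[X] := ∏ i ∈ T, (X - C (α i)) with hfdef
  have hf1 : f.natDegree = m - 1 := by
    rw [hfdef, natDegree_prod_of_monic _ _ fun i _ => monic_X_sub_C _]
    simp [hT]
  have hfm : f.Monic := monic_prod_of_monic _ _ fun i _ => monic_X_sub_C _
  have hfdeg : f.degree = (m - 1 : ℕ) := by
    rw [degree_eq_natDegree hfm.ne_zero, hf1]
  have hlast : ∀ k < m, (fun j => (f.eval (α j), 0) : Pauli L ι) ∉ rsStabilizer α k := by
    rintro k hk ⟨f', hf', g, -, h⟩
    have hd : f'.degree < (k : ℕ) := mem_degreeLT.1 hf'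
    have : f = f' := by
      refine eq_of_eval_eq_of_degree_lt_card ?_ ?_ fun x => ?_
      · rw [hfdeg]
        exact_mod_cast (by omega : m - 1 < Fintype.card L)
      · exact hd.trans (by exact_mod_cast (by omega : k < Fintype.card L))
      · simpa using congrArg Prod.fst (h (α.symm x))
    rw [← this, hfdeg] at hd
    have : m - 1 < k := by exact_mod_cast hd
    omega
  refine ⟨fun j => (f.eval (α j), 0), ⟨f, ?_, 0, Submodule.zero_mem _, fun j => by simp⟩, ?_, ?_,
    hlast⟩
  · rw [mem_degreeLT, hfdeg]
    exact_mod_cast (by omega : m - 1 < m)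
  · intro h0
    apply hlast 0 hm
    -- For `k = 0` the code already contains `0`, so lying outside it means being nonzero.
    rw [h0]
    exact zero_mem_rsStabilizer _ _
  · have hz := weight_add_ncard_zeros (fun j => (f.eval (α j), 0) : Pauli L ι)
    have : m - 1 ≤ {i | (f.eval (α i), (0 : L)) = 0}.ncard := by
      rw [← hT, ← Set.ncard_coe_finset]
      refine Set.ncard_le_ncard (fun i hi => ?_) (Set.toFinite _)
      simp only [Set.mem_ofPred_eq, Prod.mk_eq_zero, and_true]
      rw [hfdef, eval_prod]
      exact Finset.prod_eq_zero hi (by simp)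
    omega

theorem minDist_rsStabilizer (α : ι ≃ L) {m : ℕ} (hm : 0 < m) (hmN : m ≤ Fintype.card ι) :
    minDist (rsStabilizer α m) = Fintype.card ι + 1 - m := by
  classical
  obtain ⟨u, hu, hu0, hw, -⟩ := exists_mem_rsStabilizer_weight_le α hm hmN
  have hmem : weight u ∈ {d | ∃ x ∈ rsStabilizer α m, ∃ y ∈ rsStabilizer α m, x ≠ y ∧
      d = hammingDist x y} :=
    ⟨u, hu, 0, zero_mem_rsStabilizer _ _, hu0, by rw [hammingDist_eq_weight_sub, sub_zero]⟩
  apply le_antisymm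
  · exact (Nat.sInf_le (by convert! hmem)).trans (by omega)
  · refine le_csInf ⟨_, by convert! hmem⟩ ?_
    rintro d ⟨x, hx, y, hy, hxy, rfl⟩
    have h := card_lt_weight_add α (sub_mem_rsStabilizer α m hx hy) (sub_ne_zero.2 hxy)
    rw [hammingDist_eq_weight_sub]
    omega

/-- Each dot product is the sum over all of `L` of a polynomial of degree at most `k + m - 2`, and
the power sums of exponent below `|L| - 1` vanish. -/
theorem sympForm_rsStabilizer_eq_zero (α : ι ≃ L) {k m : ℕ} (hkm : k + m ≤ Fintype.card L)
    {u v : Pauli L ι} (hu : u ∈ rsStabilizer α k) (hv : v ∈ rsStabilizer α m) :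
    sympForm L ι u v = 0 := by
  obtain ⟨f, hf, g, hg, hu⟩ := hu
  obtain ⟨f', hf', g', hg', hv⟩ := hv
  have key : ∀ {a b : L[X]}, a ∈ degreeLT L k → b ∈ degreeLT L m →
      ∑ j, a.eval (α j) * b.eval (α j) = 0 := by
    intro a b ha hb
    by_cases ha0 : a = 0
    · simp [ha0]
    by_cases hb0 : b = 0
    · simp [hb0]
    have h1 := (natDegree_lt_iff_degree_lt ha0).2 (mem_degreeLT.1 ha)
    have h2 := (natDegree_lt_iff_degree_lt hb0).2 (mem_degreeLT.1 hb)
    rw [← sum_eval_eq_zero (h := a * b), ← α.sum_comp]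
    · simp
    · rw [natDegree_mul ha0 hb0]
      omega
  simp only [sympForm_apply, hu, hv, Finset.sum_sub_distrib]
  rw [key hf hg', key hg hf', sub_zero]

variable (p : ℕ) [Fact p.Prime] [Algebra (ZMod p) L]

/-- Orthogonality gives one inclusion; equality of cardinalities gives the other. -/
theorem normalizer_rsStabilizer (α : ι ≃ L) {k : ℕ} (hk : k ≤ Fintype.card ι) :
    normalizer p (rsStabilizer α k) = rsStabilizer α (Fintype.card ι - k) := by
  have hcard : Fintype.card ι = Fintype.card L := Fintype.card_congr α
  symm
  refine Set.eq_of_subset_of_ncard_le ?_ ?_ (Set.toFinite _)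
  · intro u hu
    rw [mem_normalizer_iff]
    intro v hv
    rw [sympForm_rsStabilizer_eq_zero α (by omega) hu hv, map_zero]
  · have h := ncard_mul_ncard_normalizer p (rsEval α k).range
    rw [← rsStabilizer_eq_range, ncard_rsStabilizer α (by omega)] at h
    rw [ncard_rsStabilizer α (by omega)]
    have hpos : 0 < Fintype.card L ^ (2 * k) := pow_pos Fintype.card_pos _
    refine (Nat.eq_of_mul_eq_mul_left hpos ?_).le
    rw [h, ← pow_add]
    congr 1
    omega

theorem distance_rsStabilizer (α : ι ≃ L) {k : ℕ} (hk : 2 * k ≤ Fintype.card ι) :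
    distance p (rsStabilizer α k) = k + 1 := by
  have hcard : Fintype.card ι = Fintype.card L := Fintype.card_congr α
  have hpos : 0 < Fintype.card L := Fintype.card_pos
  have hN := normalizer_rsStabilizer p α (k := k) (by omega)
  obtain ⟨u, hu, hu0, hw, hnot⟩ := exists_mem_rsStabilizer_weight_le α
    (m := Fintype.card ι - k) (by omega) (by omega)
  -- Both branches of `distance` minimize over a set of nonzero normalizer elements containing the
  -- extremal `u`, so they give the same value.
  have key : ∀ T : Set (Pauli L ι), T ⊆ rsStabilizer α (Fintype.card ι - k) \ {0} → u ∈ T →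
      sInf (weight '' T) = k + 1 := by
    intro T hT huT
    apply le_antisymm
    · exact (Nat.sInf_le (Set.mem_image_of_mem weight huT)).trans (by omega)
    · refine le_csInf ⟨_, u, huT, rfl⟩ ?_
      rintro _ ⟨v, hv, rfl⟩
      have := card_lt_weight_add α (hT hv).1 (hT hv).2
      omega
  rw [distance]
  split_ifs with h
  · rw [hN] at h
    rw [← h]
    exact key _ subset_rfl ⟨hu, hu0⟩
  · rw [hN] at h ⊢
    refine key _ (fun v hv => ⟨hv.1, ?_⟩) ⟨hu, ?_⟩
    · rintro rfl
      exact hv.2 (zero_mem_rsStabilizer _ _)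
    · refine hnot k (lt_of_le_of_ne (by omega) fun e => h ?_)
      rw [← e]

/-- Reed-Solomon stabilizers define quantum MDS codes. -/
theorem isQuantumMDS_rsStabilizer (α : ι ≃ L) {k K : ℕ} (hk : 2 * k + K = Fintype.card ι) :
    IsQuantumMDS p (rsStabilizer α k) K := by
  have hcard : Fintype.card ι = Fintype.card L := Fintype.card_congr α
  have hpos : 0 < Fintype.card L := Fintype.card_pos
  refine ⟨⟨⟨(rsEval α k).range, (rsStabilizer_eq_range _ _).symm⟩, ?_, ?_⟩, ?_, ?_⟩
  · intro x hx y hy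
    rw [pauliOp_commute_iff, sympForm_rsStabilizer_eq_zero α (by omega) hx hy, map_zero]
  · rw [ncard_rsStabilizer α (by omega)]
    congr 1
    omega
  · rw [distance_rsStabilizer p α (by omega)]
    omega
  · rw [IsClassicalMDS, normalizer_rsStabilizer p α (by omega),
      minDist_rsStabilizer α (by omega) (by omega), ncard_rsStabilizer α (by omega),
      Fintype.card_prod, ← sq, ← pow_mul]
    congr 1
    omega

end ReedSolomon

/-! ### Transitivity of the symplectic group -/

section Transvection

variable {F : Type*} [Field F] {ι : Type*} [Fintype ι]

theorem injective_of_sympForm_preserving (g : Pauli F ι →ₗ[F] Pauli F ι)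
    (hg : ∀ x y, sympForm F ι (g x) (g y) = sympForm F ι x y) : Function.Injective g := by
  rw [injective_iff_map_eq_zero]
  intro u hu
  exact eq_zero_of_sympForm_eq_zero fun v => by rw [← hg, hu, map_zero, LinearMap.zero_apply]

/-- The transvection `x ↦ x + ⟨v, w⟩⁻¹ ⟨x, w - v⟩ (w - v)` works, since `⟨v, w - v⟩ = ⟨v, w⟩`. -/
theorem exists_symplectic_of_sympForm_ne_zero {v w : Pauli F ι} (h : sympForm F ι v w ≠ 0) :
    ∃ g : Pauli F ι →ₗ[F] Pauli F ι,
      (∀ x y, sympForm F ι (g x) (g y) = sympForm F ι x y) ∧ g v = w := by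
  refine ⟨LinearMap.id + ((sympForm F ι v w)⁻¹ • (LinearMap.flip (sympForm F ι) (w - v))).smulRight (w - v),
    fun x y => ?_, ?_⟩
  · have h1 := sympForm_swap (w - v) y
    simp only [LinearMap.add_apply, LinearMap.id_apply, LinearMap.smulRight_apply,
      LinearMap.smul_apply, LinearMap.flip_apply, map_add, map_smul, smul_eq_mul,
      sympForm_self, h1]
    ring
  · have h1 : sympForm F ι v (w - v) = sympForm F ι v w := by
      rw [map_sub, sympForm_self, sub_zero]
    simp only [LinearMap.add_apply, LinearMap.id_apply, LinearMap.smulRight_apply,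
      LinearMap.smul_apply, LinearMap.flip_apply, h1, smul_eq_mul, inv_mul_cancel₀ h, one_smul]
    abel

/-- Two transvections suffice, through some `z` orthogonal to neither `v` nor `w`. If `a` is not
orthogonal to `v` and `b` not to `w`, then one of `a`, `b`, `a + b` serves as `z`. -/
theorem exists_symplectic_apply_eq {v w : Pauli F ι} (hv : v ≠ 0) (hw : w ≠ 0) :
    ∃ g : Pauli F ι →ₗ[F] Pauli F ι,
      (∀ x y, sympForm F ι (g x) (g y) = sympForm F ι x y) ∧ g v = w := by
  obtain ⟨z, hvz, hzw⟩ : ∃ z, sympForm F ι v z ≠ 0 ∧ sympForm F ι z w ≠ 0 := by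
    obtain ⟨a, ha⟩ := exists_sympForm_ne_zero hv
    obtain ⟨b, hb⟩ := exists_sympForm_ne_zero hw
    have hb' : sympForm F ι b w ≠ 0 := by rwa [sympForm_swap, neg_ne_zero]
    by_cases h1 : sympForm F ι a w = 0
    · by_cases h2 : sympForm F ι v b = 0
      · refine ⟨a + b, ?_, ?_⟩
        · rwa [map_add, h2, add_zero]
        · rwa [map_add, LinearMap.add_apply, h1, zero_add]
      · exact ⟨b, h2, hb'⟩
    · exact ⟨a, ha, h1⟩
  obtain ⟨g, hg, rfl⟩ := exists_symplectic_of_sympForm_ne_zero hvz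
  obtain ⟨g', hg', rfl⟩ := exists_symplectic_of_sympForm_ne_zero hzw
  exact ⟨g'.comp g, fun x y => by simp [hg, hg'], rfl⟩

end Transvection

/-! ### Inner codes -/

section Inner

variable {p : ℕ} [Fact p.Prime] {F : Type*} [Field F] [Algebra (ZMod p) F] {n : ℕ}

namespace InnerCode

theorem ext_XZ {C C' : InnerCode p F n} (hX : C.X = C'.X) (hZ : C.Z = C'.Z) :
    C = C' := by
  cases C
  cases C'
  cases hX
  cases hZ
  rfl

variable (C : InnerCode p F n)

theorem coset_add (c c' : Pauli F (Fin n)) : C.coset (c + c') = C.coset c + C.coset c' := by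
  simp only [coset, Pi.add_apply, Prod.fst_add, Prod.snd_add, add_smul, Finset.sum_add_distrib]
  abel

/-- The image of an inner code under a symplectic map. -/
def map (g : Pauli F (Fin n) →ₗ[F] Pauli F (Fin n))
    (hg : ∀ x y, sympForm F (Fin n) (g x) (g y) = sympForm F (Fin n) x y) : InnerCode p F n where
  X i := g (C.X i)
  Z i := g (C.Z i)
  comm_XZ i j x z := by
    rw [omegaCommutator_eq_zero_iff, ← map_smul, ← map_smul, hg, ← omegaCommutator_eq_zero_iff]
    exact C.comm_XZ i j x z
  comm_XX i j x z := by
    rw [omegaCommutator_eq_zero_iff, ← map_smul, ← map_smul, hg, ← omegaCommutator_eq_zero_iff]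
    exact C.comm_XX i j x z
  comm_ZZ i j x z := by
    rw [omegaCommutator_eq_zero_iff, ← map_smul, ← map_smul, hg, ← omegaCommutator_eq_zero_iff]
    exact C.comm_ZZ i j x z

theorem coset_map (g : Pauli F (Fin n) →ₗ[F] Pauli F (Fin n))
    (hg : ∀ x y, sympForm F (Fin n) (g x) (g y) = sympForm F (Fin n) x y)
    (c : Pauli F (Fin n)) : (C.map g hg).coset c = g (C.coset c) := by
  simp [coset, map]

theorem map_injective (g : Pauli F (Fin n) →ₗ[F] Pauli F (Fin n))
    (hg : ∀ x y, sympForm F (Fin n) (g x) (g y) = sympForm F (Fin n) x y) :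
    Function.Injective fun C : InnerCode p F n => C.map g hg := by
  have hinj := injective_of_sympForm_preserving g hg
  intro C C' h
  exact ext_XZ (funext fun i => hinj (congrFun (congrArg InnerCode.X h) i))
    (funext fun i => hinj (congrFun (congrArg InnerCode.Z h) i))

instance [Fintype F] : Finite (InnerCode p F n) :=
  Finite.of_injective (fun C => (C.X, C.Z)) fun _ _ h =>
    ext_XZ (congrArg Prod.fst h) (congrArg Prod.snd h)

instance [Fintype F] : Nonempty (InnerCode p F n) := by
  classical
  refine ⟨⟨fun i => Pi.single i (1, 0), fun i => Pi.single i (0, 1), ?_, ?_, ?_⟩⟩ <;>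
    intro i j x z <;>
    rw [omegaCommutator_eq_zero_iff, LinearMap.map_smul, LinearMap.map_smul,
      LinearMap.smul_apply, sympForm_single_left] <;>
    by_cases h : i = j <;> simp [h, phase_zero, mul_comm]

variable [Fintype F]

/-- One commutation relation fixes only a trace. The relations for all powers fix the traces of all
multiples, hence the value in `F`. -/
theorem sympForm_X_Z (i j : Fin n) :
    sympForm F (Fin n) (C.X i) (C.Z j) = if i = j then 1 else 0 := by
  refine (sub_eq_zero.1 (eq_zero_of_trace_mul_eq_zero p fun c => ?_)).symm
  have h := C.comm_XZ i j c 1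
  rw [omegaCommutator_eq_zero_iff, phase_eq_phase_iff, one_smul, map_smul,
    LinearMap.smul_apply, smul_eq_mul] at h
  rw [mul_sub, map_sub, ← h]
  split_ifs <;> simp

theorem sympForm_X_X (i j : Fin n) : sympForm F (Fin n) (C.X i) (C.X j) = 0 := by
  refine eq_zero_of_trace_mul_eq_zero p fun c => ?_
  have h := C.comm_XX i j c 1
  rwa [omegaCommutator_eq_zero_iff, eq_comm, phase_eq_one_iff, one_smul, map_smul,
    LinearMap.smul_apply, smul_eq_mul] at h

theorem sympForm_Z_Z (i j : Fin n) : sympForm F (Fin n) (C.Z i) (C.Z j) = 0 := by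
  refine eq_zero_of_trace_mul_eq_zero p fun c => ?_
  have h := C.comm_ZZ i j c 1
  rwa [omegaCommutator_eq_zero_iff, eq_comm, phase_eq_one_iff, one_smul, map_smul,
    LinearMap.smul_apply, smul_eq_mul] at h

/-- The logical operators have the same Gram matrix as the standard `X` and `Z` generators. -/
theorem sympForm_coset (c c' : Pauli F (Fin n)) :
    sympForm F (Fin n) (C.coset c) (C.coset c') = sympForm F (Fin n) c c' := by
  have hZX : ∀ i j, sympForm F (Fin n) (C.Z i) (C.X j) = if i = j then -1 else 0 := by
    intro i j
    rw [sympForm_swap, sympForm_X_Z]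
    simp only [eq_comm (a := j)]
    split_ifs <;> simp
  simp only [coset, map_add, map_sum, map_smul, LinearMap.add_apply, LinearMap.coe_sum,
    Finset.sum_apply, LinearMap.smul_apply, smul_eq_mul, sympForm_X_Z, sympForm_X_X,
    sympForm_Z_Z, hZX, mul_zero, Finset.sum_const_zero, mul_ite, mul_one, mul_neg,
    Finset.sum_ite_eq', Finset.mem_univ, if_true, add_zero, zero_add]
  rw [sympForm_apply, ← Finset.sum_add_distrib]
  exact Finset.sum_congr rfl fun i _ => by ring

theorem coset_ne_zero {c : Pauli F (Fin n)} (hc : c ≠ 0) : C.coset c ≠ 0 := by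
  intro h
  obtain ⟨d, hd⟩ := exists_sympForm_ne_zero hc
  rw [← C.sympForm_coset, h, map_zero] at hd
  exact hd rfl

/-- Composition with a symplectic map taking `v` to `w` injects one family of codes into the other.
By symmetry the counts are equal, which is the equidistribution behind the probability bound. -/
theorem ncard_coset_eq_le {c v w : Pauli F (Fin n)} (hv : v ≠ 0) (hw : w ≠ 0) :
    {C : InnerCode p F n | C.coset c = v}.ncard ≤ {C : InnerCode p F n | C.coset c = w}.ncard := by
  obtain ⟨g, hg, rfl⟩ := exists_symplectic_apply_eq hv hw
  refine Set.ncard_le_ncard_of_injOn (fun C => C.map g hg) ?_ (map_injective g hg).injOn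
    (Set.toFinite _)
  rintro C rfl
  exact C.coset_map g hg c

/-- A nonzero label is encoded as each Pauli with probability at most `1 / (q^{2n} - 1)`. -/
theorem ncard_coset_eq_mul_le {c : Pauli F (Fin n)} (hc : c ≠ 0) (v : Pauli F (Fin n)) :
    {C : InnerCode p F n | C.coset c = v}.ncard * (Fintype.card F ^ (2 * n) - 1) ≤
      Nat.card (InnerCode p F n) := by
  classical
  by_cases hv : v = 0
  · have : {C : InnerCode p F n | C.coset c = v} = ∅ := by
      rw [Set.eq_empty_iff_forall_notMem]
      intro C hC
      exact C.coset_ne_zero hc (hC.out.trans hv)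
    simp [this]
  have := Fintype.ofFinite (InnerCode p F n)
  have hfib := Finset.card_eq_sum_card_fiberwise (f := fun C : InnerCode p F n => C.coset c)
    (s := Finset.univ) (t := Finset.univ.erase 0) (fun C _ => by simp [C.coset_ne_zero hc])
  have hcard : (Finset.univ.erase (0 : Pauli F (Fin n))).card = Fintype.card F ^ (2 * n) - 1 := by
    rw [Finset.card_erase_of_mem (Finset.mem_univ _), Finset.card_univ,
      ← Nat.card_eq_fintype_card, natCard_pauli, Fintype.card_fin]
  rw [Nat.card_eq_fintype_card, ← Finset.card_univ (α := InnerCode p F n), hfib, mul_comm, ← hcard, ← smul_eq_mul]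
  -- The `q^(2n) - 1` fibres over nonzero Paulis partition all codes, and each is at least as large
  -- as the fibre over `v`.
  refine Finset.card_nsmul_le_sum _ _ _ fun w hw => ?_
  refine (ncard_coset_eq_le (c := c) hv (Finset.ne_of_mem_erase hw)).trans ?_
  rw [← Set.ncard_coe_finset]
  simp

instance : MeasurableSingletonClass (InnerCode p F n) := ⟨fun _ => trivial⟩

instance : MeasureTheory.IsProbabilityMeasure
    (ProbabilityTheory.uniformOn (Set.univ : Set (InnerCode p F n))) :=
  ProbabilityTheory.isProbabilityMeasure_uniformOn Set.finite_univ Set.univ_nonempty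

theorem uniformOn_coset_eq_le (hF : 2 ≤ Fintype.card F ^ (2 * n)) {c : Pauli F (Fin n)}
    (hc : c ≠ 0) (v : Pauli F (Fin n)) :
    (ProbabilityTheory.uniformOn Set.univ).real {C : InnerCode p F n | C.coset c = v} ≤
      ((Fintype.card F : ℝ) ^ (2 * n) - 1)⁻¹ := by
  have := Fintype.ofFinite (InnerCode p F n)
  have h := ncard_coset_eq_mul_le (p := p) hc v
  rw [MeasureTheory.measureReal_def, ProbabilityTheory.uniformOn_univ, ENNReal.toReal_div,
    MeasureTheory.Measure.count_apply (MeasurableSpace.measurableSet_top)]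
  have h1 : (Set.encard {C : InnerCode p F n | C.coset c = v} : ENNReal).toReal =
      ({C : InnerCode p F n | C.coset c = v}.ncard : ℝ) := by
    rw [← Set.Finite.cast_ncard_eq (Set.toFinite _), ENat.toENNReal_coe, ENNReal.toReal_natCast]
  rw [h1, ENNReal.toReal_natCast]
  have hpos : (0 : ℝ) < Fintype.card (InnerCode p F n) := by exact_mod_cast Fintype.card_pos
  have hF' : (2 : ℝ) ≤ (Fintype.card F : ℝ) ^ (2 * n) := by exact_mod_cast hF
  rw [inv_eq_one_div, div_le_div_iff₀ hpos (by linarith), one_mul]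
  rw [Nat.card_eq_fintype_card] at h
  have h2 : (((Fintype.card F ^ (2 * n) - 1 : ℕ)) : ℝ) = (Fintype.card F : ℝ) ^ (2 * n) - 1 := by
    rw [Nat.cast_sub (by omega)]
    simp
  rw [← h2]
  exact_mod_cast h

end InnerCode

end Inner

/-! ### Concatenation -/

section Concatenation

variable {p : ℕ} [Fact p.Prime] {F : Type*} [Field F] [Algebra (ZMod p) F] {n : ℕ}
  {L : Type*} [Field L] [Algebra F L] (b : Module.Basis (Fin n) F L)

/-- Expanding one factor in the basis `b` and using linearity of the trace gives `∑ xᵢ Tr(y bᵢ) =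
Tr(x y)`. -/
theorem sympForm_blockLabel (u v : L × L) :
    sympForm F (Fin n) (blockLabel b u) (blockLabel b v) =
      Algebra.trace F L (u.1 * v.2 - u.2 * v.1) := by
  have key : ∀ x y : L, ∑ i, b.repr x i * Algebra.trace F L (y * b i) =
      Algebra.trace F L (x * y) := by
    intro x y
    conv_rhs => rw [← b.sum_repr x]
    rw [Finset.sum_mul, map_sum]
    refine Finset.sum_congr rfl fun i _ => ?_
    rw [smul_mul_assoc, map_smul, smul_eq_mul, mul_comm y]
  rw [map_sub, ← key, mul_comm u.2, ← key, sympForm_apply, ← Finset.sum_sub_distrib]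
  exact Finset.sum_congr rfl fun i _ => by simp only [blockLabel]; ring

theorem blockLabel_add (u v : L × L) :
    blockLabel b (u + v) = blockLabel b u + blockLabel b v := by
  funext i
  ext <;> simp [blockLabel, add_mul]

/-- The encoding as a homomorphism. -/
def encodeHom {M : ℕ} (C : Fin M → InnerCode p F n) :
    Pauli L (Fin M) →+ Pauli F (Fin M × Fin n) :=
  AddMonoidHom.mk' (encode b C) fun u v => by
    funext ji
    simp only [encode, Pi.add_apply, blockLabel_add]
    rw [InnerCode.coset_add, Pi.add_apply]

variable [Fintype F] [Fintype L] {M : ℕ}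

theorem blockLabel_ne_zero {u : L × L} (hu : u ≠ 0) : blockLabel b u ≠ 0 := by
  intro h
  have h0 : ∀ v : L × L, Algebra.trace F L (u.1 * v.2 - u.2 * v.1) = 0 := fun v => by
    rw [← sympForm_blockLabel b, h, map_zero, LinearMap.zero_apply]
  have hnd := (traceForm_nondegenerate F L).1
  apply hu
  ext
  · exact hnd _ fun y => by simpa using h0 (0, y)
  · exact hnd _ fun y => by simpa using h0 (y, 0)

theorem card_eq_of_basis (b : Module.Basis (Fin n) F L) : Fintype.card L = Fintype.card F ^ n := by
  rw [Module.card_fintype b, Fintype.card_fin]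

instance : MeasureTheory.IsProbabilityMeasure (innerLaw p F n M) := by
  unfold innerLaw
  infer_instance

/-- The event is a product of events on the independent blocks; each block with `u j ≠ 0`
contributes one small factor, the others at most `1`. -/
theorem innerLaw_encode_eq_le (hF : 2 ≤ Fintype.card F ^ (2 * n)) (u : Pauli L (Fin M))
    (v : Pauli F (Fin M × Fin n)) :
    (innerLaw p F n M).real {C | encode b C u = v} ≤
      (((Fintype.card F : ℝ) ^ (2 * n) - 1)⁻¹) ^ weight u := by
  classical
  set r : ℝ := ((Fintype.card F : ℝ) ^ (2 * n) - 1)⁻¹ with hr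
  have hset : {C : Fin M → InnerCode p F n | encode b C u = v} =
      Set.univ.pi fun j => {C | C.coset (blockLabel b (u j)) = fun i => v (j, i)} := by
    ext C
    simp only [Set.mem_ofPred_eq, Set.mem_univ_pi, funext_iff, Prod.forall, encode]
  have hw : r ^ weight u = ∏ j, if u j = 0 then 1 else r := by
    rw [Finset.prod_ite, Finset.prod_const_one, one_mul, Finset.prod_const, weight,
      ← Set.ncard_coe_finset]
    simp
  rw [hset, MeasureTheory.measureReal_def, innerLaw, MeasureTheory.Measure.pi_pi,
    ENNReal.toReal_prod, hw]
  refine Finset.prod_le_prod (fun _ _ => ENNReal.toReal_nonneg) fun j _ => ?_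
  split_ifs with h
  · exact MeasureTheory.measureReal_le_one
  · exact InnerCode.uniformOn_coset_eq_le hF (blockLabel_ne_zero b h) _

theorem encode_apply_eq_zero_iff (C : Fin M → InnerCode p F n) (u : Pauli L (Fin M)) (j : Fin M) :
    (∀ i, encode b C u (j, i) = 0) ↔ u j = 0 := by
  constructor
  · intro h
    by_contra h0
    exact (C j).coset_ne_zero (blockLabel_ne_zero b h0) (funext h)
  · intro h i
    have h1 : blockLabel b (0 : L × L) = 0 := by
      funext i
      simp [blockLabel]
    simp [encode, h, h1, InnerCode.coset]

variable [Algebra (ZMod p) L]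

theorem trace_sympForm_encode (C : Fin M → InnerCode p F n) (u v : Pauli L (Fin M)) :
    Algebra.trace (ZMod p) F (sympForm F (Fin M × Fin n) (encode b C u) (encode b C v)) =
      Algebra.trace (ZMod p) L (sympForm L (Fin M) u v) := by
  -- Ring homomorphisms out of `ZMod p` are unique, so the given algebra structures are compatible
  -- and traces can be composed.
  have : IsScalarTower (ZMod p) F L := IsScalarTower.of_algebraMap_eq' (Subsingleton.elim _ _)
  have h : sympForm F (Fin M × Fin n) (encode b C u) (encode b C v) =
      Algebra.trace F L (sympForm L (Fin M) u v) := by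
    rw [sympForm_apply, Fintype.sum_prod_type, sympForm_apply, map_sum]
    refine Finset.sum_congr rfl fun j _ => ?_
    rw [← sympForm_blockLabel b, ← (C j).sympForm_coset, sympForm_apply]
    rfl
  rw [h, Algebra.trace_trace]

theorem encode_injective (C : Fin M → InnerCode p F n) : Function.Injective (encode b C) := by
  refine (injective_iff_map_eq_zero (encodeHom b C)).2 fun u hu => ?_
  refine eq_zero_of_trace_sympForm_eq_zero p fun v => ?_
  have hu' : encode b C u = 0 := hu
  rw [← trace_sympForm_encode b C, hu', map_zero, LinearMap.zero_apply, map_zero]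

theorem encode_surjective (C : Fin M → InnerCode p F n) : Function.Surjective (encode b C) := by
  refine ((Nat.bijective_iff_injective_and_card _).2 ⟨encode_injective b C, ?_⟩).2
  rw [natCard_pauli, natCard_pauli, card_eq_of_basis b, Fintype.card_prod, Fintype.card_fin,
    Fintype.card_fin, ← pow_mul]
  congr 1
  ring

/-- Encoding is a bijection of all Paulis preserving the commutation form. -/
theorem normalizer_concatStabilizer (S : Set (Pauli L (Fin M))) (C : Fin M → InnerCode p F n) :
    normalizer p (concatStabilizer b S C) = encode b C '' normalizer p S := by
  ext x
  obtain ⟨u, rfl⟩ := encode_surjective b C x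
  rw [(encode_injective b C).mem_set_image, mem_normalizer_iff, mem_normalizer_iff,
    concatStabilizer, Set.forall_mem_image]
  exact forall₂_congr fun v _ => by rw [trace_sympForm_encode]

theorem isStabilizer_concatStabilizer {S : Set (Pauli L (Fin M))} {m : ℕ}
    (hS : IsStabilizer p S m) (C : Fin M → InnerCode p F n) :
    IsStabilizer p (concatStabilizer b S C) (n * m) := by
  obtain ⟨⟨G, rfl⟩, hcomm, hcard⟩ := hS
  refine ⟨⟨G.map (encodeHom b C), rfl⟩, ?_, ?_⟩
  · rintro _ ⟨u, hu, rfl⟩ _ ⟨v, hv, rfl⟩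
    rw [pauliOp_commute_iff, trace_sympForm_encode, ← pauliOp_commute_iff]
    exact hcomm u hu v hv
  · rw [concatStabilizer, Set.ncard_image_of_injective _ (encode_injective b C), hcard,
      card_eq_of_basis b, pow_mul]

/-- The condition `distance p S ≠ 0` excludes the default `sInf ∅ = 0`, so the minimum for the
concatenated code is attained, in either branch of `distance`. -/
theorem exists_weight_eq_distance {S : Set (Pauli L (Fin M))} (hS : 0 ∈ S)
    (hd : distance p S ≠ 0) (C : Fin M → InnerCode p F n) :
    ∃ u ∈ normalizer p S, u ≠ 0 ∧
      weight (encode b C u) = distance p (concatStabilizer b S C) := by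
  have hinj := encode_injective b C
  have hE0 : encode b C 0 = 0 := (encodeHom b C).map_zero
  have key : ∀ T : Set (Pauli L (Fin M)), sInf (weight '' T) ≠ 0 →
      ∃ u ∈ T, weight (encode b C u) = sInf (weight '' (encode b C '' T)) := by
    intro T hT
    have hne : T.Nonempty := by
      by_contra h
      rw [Set.not_nonempty_iff_eq_empty] at h
      simp [h] at hT
    obtain ⟨_, ⟨u, hu, rfl⟩, h⟩ := Nat.sInf_mem ((hne.image (encode b C)).image weight)
    exact ⟨u, hu, h⟩
  have hiff : normalizer p (concatStabilizer b S C) = concatStabilizer b S C ↔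
      normalizer p S = S := by
    rw [normalizer_concatStabilizer, concatStabilizer, hinj.image_injective.eq_iff]
  rw [distance] at hd ⊢
  by_cases h : normalizer p S = S
  · rw [if_pos h] at hd
    rw [if_pos (hiff.2 h)]
    obtain ⟨u, hu, hw⟩ := key _ hd
    refine ⟨u, h.symm ▸ hu.1, hu.2, hw.trans ?_⟩
    rw [Set.image_sdiff hinj, Set.image_singleton, hE0]
    rfl
  · rw [if_neg h] at hd
    rw [if_neg (hiff.not.2 h)]
    obtain ⟨u, hu, hw⟩ := key _ hd
    refine ⟨u, hu.1, ?_, hw.trans ?_⟩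
    · rintro rfl
      exact hu.2 hS
    · rw [Set.image_sdiff hinj, normalizer_concatStabilizer]
      rfl

end Concatenation

/-! ### Codewords of MDS codes with given support -/

section Support

theorem minDist_le_hammingDist {ι A : Type*} [Fintype ι] {_ : DecidableEq A} {C : Set (ι → A)}
    {x y : ι → A} (hx : x ∈ C) (hy : y ∈ C) (hxy : x ≠ y) : minDist C ≤ hammingDist x y := by
  rw [minDist]
  refine Nat.sInf_le ⟨x, hx, y, hy, hxy, ?_⟩
  congr!

/-- A code of minimum distance at least `e + 1` has at most `(|A| - 1)^{|W| - e}` codewords of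
support exactly `W`. -/
theorem ncard_support_eq_le {ι A : Type*} [Fintype ι] [Fintype A] [Zero A] [DecidableEq A]
    [DecidableEq ι] {C : Set (ι → A)} {e : ℕ}
    (hC : ∀ x ∈ C, ∀ y ∈ C, x ≠ y → e < hammingDist x y) (W : Finset ι) (hW : e ≤ W.card) :
    {x | x ∈ C ∧ ∀ i, x i ≠ 0 ↔ i ∈ W}.ncard ≤ (Fintype.card A - 1) ^ (W.card - e) := by
  -- The nonzero entries on `T` determine the codeword: two that agree there differ in at most `e`
  -- places.
  obtain ⟨T, hTW, hT⟩ := Finset.exists_subset_card_eq (s := W) (n := W.card - e) (by omega)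
  have hcard : Nat.card (T → {a : A // a ≠ 0}) = (Fintype.card A - 1) ^ (W.card - e) := by
    rw [Nat.card_fun, Nat.card_eq_fintype_card, Nat.card_eq_fintype_card,
      Fintype.card_subtype_compl, Fintype.card_subtype_eq, Fintype.card_coe, hT]
  rw [← hcard, ← Nat.card_coe_set_eq]
  refine Nat.card_le_card_of_injective
    (fun x t => ⟨x.1 t, (x.2.2 t).2 (hTW t.2)⟩) ?_
  rintro ⟨x, hx, hxW⟩ ⟨y, hy, hyW⟩ h
  rw [Subtype.mk.injEq]
  by_contra hxy
  have h1 := hC x hx y hy hxy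
  have h2 : hammingDist x y ≤ (W \ T).card := by
    rw [hammingDist]
    refine Finset.card_le_card fun i hi => ?_
    rw [Finset.mem_filter] at hi
    rw [Finset.mem_sdiff]
    refine ⟨?_, fun hiT => hi.2 (congrArg Subtype.val (congrFun h ⟨i, hiT⟩))⟩
    by_contra hiW
    exact hi.2 ((not_not.1 ((hxW i).not.2 hiW)).trans (not_not.1 ((hyW i).not.2 hiW)).symm)
  rw [Finset.card_sdiff_of_subset hTW] at h2
  omega

end Support

/-! ### Entropy -/

section Entropy

theorem qaryEntropy_one_sub_inv {Q : ℕ} (hQ : 2 ≤ Q) :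
    Real.qaryEntropy Q (1 - 1 / (Q : ℝ)) = Real.log Q := by
  have hQ' : (2 : ℝ) ≤ Q := by exact_mod_cast hQ
  have h1 : 1 - 1 / (Q : ℝ) = (Q - 1) / Q := by field_simp
  have h2 : (1 : ℝ) - (Q - 1) / Q = 1 / Q := by field_simp; ring
  have h3 : ((Q - 1 : ℤ) : ℝ) = (Q : ℝ) - 1 := by push_cast; ring
  rw [Real.qaryEntropy, h1, Real.binEntropy, h2, h3, inv_div, Real.log_div (by linarith)
    (by linarith), one_div, inv_inv]
  field_simp
  ring

theorem entropy_zero (Q : ℕ) : entropy Q 0 = 0 := by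
  simp [entropy]

theorem entropy_one_sub_inv {Q : ℕ} (hQ : 2 ≤ Q) : entropy Q (1 - 1 / (Q : ℝ)) = 1 := by
  rw [entropy, qaryEntropy_one_sub_inv hQ, div_self]
  exact (Real.log_pos (by exact_mod_cast hQ)).ne'

theorem one_sub_inv_mem_Icc {Q : ℕ} (hQ : 2 ≤ Q) : 1 - 1 / (Q : ℝ) ∈ Set.Icc (0 : ℝ) 1 := by
  have hQ' : (2 : ℝ) ≤ Q := by exact_mod_cast hQ
  constructor
  · rw [sub_nonneg, div_le_one (by linarith)]
    linarith
  · rw [sub_le_self_iff]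
    positivity

theorem entropy_strictMonoOn {Q : ℕ} (hQ : 2 ≤ Q) :
    StrictMonoOn (entropy Q) (Set.Icc 0 (1 - 1 / (Q : ℝ))) := fun _ hx _ hy hxy =>
  div_lt_div_of_pos_right (Real.qaryEntropy_strictMonoOn hQ hx hy hxy)
    (Real.log_pos (by exact_mod_cast hQ))

theorem entropy_concaveOn {Q : ℕ} (hQ : 2 ≤ Q) : ConcaveOn ℝ (Set.Icc 0 1) (entropy Q) := by
  have h := (Real.strictConcaveOn_qaryEntropy (q := Q)).concaveOn.smul
    (inv_nonneg.2 (Real.log_pos (x := (Q : ℝ)) (by exact_mod_cast hQ)).le)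
  refine h.congr fun x _ => ?_
  simp [entropy, div_eq_inv_mul]

theorem exists_entropy_eq {Q : ℕ} (hQ : 2 ≤ Q) {y : ℝ} (hy : y ∈ Set.Icc (0 : ℝ) 1) :
    ∃ x ∈ Set.Icc 0 (1 - 1 / (Q : ℝ)), entropy Q x = y := by
  have hc : ContinuousOn (entropy Q) (Set.Icc 0 (1 - 1 / (Q : ℝ))) :=
    (Real.qaryEntropy_continuous.div_const _).continuousOn
  have h := intermediate_value_Icc (one_sub_inv_mem_Icc hQ).1 hc
  rw [entropy_zero, entropy_one_sub_inv hQ] at h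
  exact h hy

theorem entropyInv_mem {Q : ℕ} (hQ : 2 ≤ Q) {y : ℝ} (hy : y ∈ Set.Icc (0 : ℝ) 1) :
    entropyInv Q y ∈ Set.Icc 0 (1 - 1 / (Q : ℝ)) :=
  Function.invFunOn_mem (exists_entropy_eq hQ hy)

theorem entropy_entropyInv {Q : ℕ} (hQ : 2 ≤ Q) {y : ℝ} (hy : y ∈ Set.Icc (0 : ℝ) 1) :
    entropy Q (entropyInv Q y) = y :=
  Function.invFunOn_eq (exists_entropy_eq hQ hy)

/-- Where the entropy is at most `1 / 2`, it grows at least with slope `1 / 2`. -/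
theorem half_sub_le_entropy_sub {Q : ℕ} (hQ : 2 ≤ Q) {x y : ℝ} (hx : 0 ≤ x) (hxy : x ≤ y)
    (hy : y ≤ 1 - 1 / (Q : ℝ)) (hH : entropy Q y ≤ 1 / 2) :
    (y - x) / 2 ≤ entropy Q y - entropy Q x := by
  rcases hxy.eq_or_lt with rfl | hxy
  · simp
  have h1 := entropy_one_sub_inv hQ
  have hz := one_sub_inv_mem_Icc hQ
  set z := 1 - 1 / (Q : ℝ)
  rcases hy.eq_or_lt with rfl | hyz
  · linarith
  -- The slope on `[x, y]` is at least that on `[y, z]`, where the entropy rises by at least `1/2`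
  -- over a length at most `1`.
  have hs := (entropy_concaveOn hQ).slope_anti_adjacent ⟨hx, by linarith [hz.2]⟩ hz hxy hyz
  rw [h1, div_le_div_iff₀ (by linarith) (by linarith)] at hs
  have h2 : (y - x) * (z - y) ≤ 2 * ((entropy Q y - entropy Q x) * (z - y)) := by
    nlinarith [hz.2, mul_nonneg (sub_nonneg.2 hxy.le) (sub_nonneg.2 hyz.le)]
  have h3 : 0 < z - y := by linarith
  have h4 : (y - x) * (z - y) ≤ (2 * (entropy Q y - entropy Q x)) * (z - y) := by linarith
  have := le_of_mul_le_mul_right h4 h3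
  linarith

/-- The inverse entropy at `1/2` lies in `(0, 1]`, so both logarithms have arguments at least `1`.
-/
theorem fbar_nonneg {q : ℕ} (hq : 2 ≤ q) : 0 ≤ fbar q := by
  have hQ : 2 ≤ q ^ 2 := by nlinarith
  have hq' : (2 : ℝ) ≤ q := by exact_mod_cast hq
  have hh : (1 / 2 : ℝ) ∈ Set.Icc (0 : ℝ) 1 := by norm_num
  have hm := entropyInv_mem hQ hh
  have he := entropy_entropyInv hQ hh
  rw [fbar]
  set x := entropyInv (q ^ 2) (1 / 2)
  have hx0 : 0 < x := by
    refine hm.1.lt_of_ne fun h => ?_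
    rw [← h, entropy_zero] at he
    norm_num at he
  have hx1 : x ≤ 1 := hm.2.trans (one_sub_inv_mem_Icc hQ).2
  refine div_nonneg (Real.logb_nonneg (by linarith) (by norm_num))
    (Real.logb_nonneg (by nlinarith) ?_)
  have h1 : 1 ≤ 2 / x - 1 := by
    rw [le_sub_iff_add_le, le_div_iff₀ hx0]
    linarith
  have h2 : 1 ≤ (q : ℝ) ^ 2 - 1 := by nlinarith
  nlinarith

end Entropy

/-! ### The volume of Hamming balls -/

section Ball

variable {F : Type*} [Field F] [Fintype F] {κ : Type*} [Fintype κ]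

/-- The weight enumerator factors over positions: the identity contributes `1`, each other Pauli
`t`. -/
theorem sum_pow_weight (t : ℝ) :
    ∑ᶠ v : Pauli F κ, t ^ weight v =
      (1 + ((Fintype.card F : ℝ) ^ 2 - 1) * t) ^ Fintype.card κ := by
  classical
  have h : ∀ v : Pauli F κ, t ^ weight v = ∏ i, if v i = 0 then 1 else t := by
    intro v
    rw [Finset.prod_ite, Finset.prod_const_one, one_mul, Finset.prod_const, weight,
      ← Set.ncard_coe_finset]
    simp
  have hsum : ∑ a : F × F, (if a = 0 then 1 else t) = 1 + ((Fintype.card F : ℝ) ^ 2 - 1) * t := by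
    have h1 : ∀ a : F × F, (if a = 0 then 1 else t) = t + if a = 0 then 1 - t else 0 := by
      intro a
      split_ifs <;> ring
    simp only [h1, Finset.sum_add_distrib, Finset.sum_ite_eq', Finset.sum_const, Finset.card_univ,
      Fintype.card_prod, nsmul_eq_mul, Finset.mem_univ, if_true]
    push_cast
    ring
  rw [finsum_eq_sum_of_fintype]
  simp only [h]
  rw [← hsum, ← Finset.card_univ, ← Finset.prod_const, Finset.prod_univ_sum, Fintype.piFinset_univ]

/-- The volume of the Hamming ball of relative radius `x`. -/
theorem ncard_weight_le (x : ℝ) (hx : 0 < x) (hx1 : x ≤ 1 - 1 / ((Fintype.card F ^ 2 : ℕ) : ℝ)) :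
    ({v : Pauli F κ | (weight v : ℝ) ≤ x * Fintype.card κ}.ncard : ℝ) ≤
      Real.exp (Fintype.card κ * Real.qaryEntropy (Fintype.card F ^ 2) x) := by
  classical
  set Q : ℕ := Fintype.card F ^ 2 with hQdef
  have hF : 2 ≤ Fintype.card F := Fintype.one_lt_card
  have hQ : 2 ≤ Q := by nlinarith
  have hQ' : (2 : ℝ) ≤ Q := by exact_mod_cast hQ
  have hxlt : x < 1 := hx1.trans_lt (by
    rw [sub_lt_self_iff]
    positivity)
  have hden : 0 < (1 - x) * ((Q : ℝ) - 1) := mul_pos (by linarith) (by linarith)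
  -- The Chernoff parameter minimizing `(1 + (Q - 1) t) / t^x`. It is at most `1` exactly when `x ≤
  -- 1 - 1/Q`, and then `t^(x |κ|) ≤ t^(weight v)` inside the ball.
  set t : ℝ := x / ((1 - x) * (Q - 1)) with ht
  have ht0 : 0 < t := div_pos hx hden
  have ht1 : t ≤ 1 := by
    rw [ht, div_le_one hden]
    have : x * Q ≤ Q - 1 := by
      have := mul_le_mul_of_nonneg_right hx1 (by linarith : (0 : ℝ) ≤ Q)
      rwa [sub_mul, one_mul, one_div, inv_mul_cancel₀ (by linarith)] at this
    nlinarith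
  have hgen : 1 + ((Q : ℝ) - 1) * t = (1 - x)⁻¹ := by
    have h1 : (1 : ℝ) - x ≠ 0 := by linarith
    have h2 : (Q : ℝ) - 1 ≠ 0 := by linarith
    rw [ht]
    field_simp
    ring
  have hcount : ({v : Pauli F κ | (weight v : ℝ) ≤ x * Fintype.card κ}.ncard : ℝ) *
      t ^ (x * Fintype.card κ) ≤ ((1 - x)⁻¹) ^ Fintype.card κ := by
    have hs := sum_pow_weight (F := F) (κ := κ) t
    rw [← Nat.cast_pow, ← hQdef, hgen, finsum_eq_sum_of_fintype] at hs
    rw [← hs, Set.ncard_eq_toFinset_card', ← nsmul_eq_mul]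
    refine (Finset.card_nsmul_le_sum _ (fun v => t ^ weight v) _ fun v hv => ?_).trans
      (Finset.sum_le_sum_of_subset_of_nonneg (Finset.subset_univ _) fun _ _ _ => by positivity)
    rw [Set.mem_toFinset] at hv
    rw [← Real.rpow_natCast]
    exact Real.rpow_le_rpow_of_exponent_ge ht0 ht1 hv
  have hpos : 0 < t ^ (x * Fintype.card κ) := Real.rpow_pos_of_pos ht0 _
  rw [← le_div_iff₀ hpos] at hcount
  refine hcount.trans_eq ?_
  rw [Real.rpow_def_of_pos ht0, ← Real.rpow_natCast, Real.rpow_def_of_pos (by simpa using hxlt),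
    ← Real.exp_sub]
  congr 1
  have h3 : ((Q - 1 : ℤ) : ℝ) = (Q : ℝ) - 1 := by push_cast; ring
  rw [ht, Real.log_div hx.ne' hden.ne', Real.log_mul (by linarith) (by linarith),
    Real.qaryEntropy, Real.binEntropy, h3, Real.log_inv, Real.log_inv]
  ring

end Ball

/-! ### The distance of random concatenated codes -/

section UnionBound

/-- The quantum distance says nothing about low-weight elements of `S` when `N(S) ≠ S`. The distance
of the whole normalizer comes instead from its size `|L|^(N + K)` and MDS equality. -/
theorem minDist_normalizer {p : ℕ} [Fact p.Prime] {L : Type*} [Field L] [Fintype L]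
    [Algebra (ZMod p) L] {ι : Type*} [Fintype ι] [Nonempty ι] {S : Set (Pauli L ι)} {K : ℕ}
    (hS : IsQuantumMDS p S K) (hK : K ≤ Fintype.card ι) :
    2 * minDist (normalizer p S) + K = Fintype.card ι + 2 := by
  obtain ⟨⟨⟨G, rfl⟩, -, hcard⟩, -, hmds⟩ := hS
  have h := ncard_mul_ncard_normalizer p G
  rw [IsClassicalMDS, Fintype.card_prod, ← sq, ← pow_mul] at hmds
  rw [hcard, hmds, ← pow_add] at h
  have h' := Nat.pow_right_injective (Fintype.one_lt_card (α := L)) h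
  have hpos : 0 < Fintype.card ι := Fintype.card_pos
  -- Positive length rules out truncation of the exponent `N + 1 - D` to zero.
  omega

variable {p : ℕ} [Fact p.Prime] {F : Type*} [Field F] [Algebra (ZMod p) F] {n : ℕ}
  {L : Type*} [Field L] [Algebra F L] (b : Module.Basis (Fin n) F L)
  [Fintype F] [Fintype L] {M : ℕ}

/-- The count `r^(|W| - e)` of candidates with the block support `W` of `v` cancels against the
probability `r^(-|W|)` of each, since both have base `r = |L × L| - 1`. -/
theorem innerLaw_exists_encode_eq_le (hF : 2 ≤ Fintype.card F ^ (2 * n))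
    {N : Set (Pauli L (Fin M))} {e : ℕ} (h0 : 0 ∈ N) (he : e < minDist N)
    (v : Pauli F (Fin M × Fin n)) :
    (innerLaw p F n M).real {C | ∃ u ∈ N, u ≠ 0 ∧ encode b C u = v} ≤
      (((Fintype.card F : ℝ) ^ (2 * n) - 1)⁻¹) ^ e := by
  classical
  set r : ℝ := (Fintype.card F : ℝ) ^ (2 * n) - 1 with hr
  have hr1 : 1 ≤ r := by
    have : (2 : ℝ) ≤ (Fintype.card F : ℝ) ^ (2 * n) := by exact_mod_cast hF
    linarith
  have hC : ∀ x ∈ N, ∀ y ∈ N, x ≠ y → e < hammingDist x y := fun x hx y hy hxy =>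
    he.trans_le (minDist_le_hammingDist hx hy hxy)
  set W : Finset (Fin M) := {j | ∃ i, v (j, i) ≠ 0} with hW
  set U : Set (Pauli L (Fin M)) := {u | u ∈ N ∧ ∀ j, u j ≠ 0 ↔ j ∈ W} with hU
  have hweight : ∀ u ∈ U, weight u = W.card := by
    intro u hu
    rw [weight, ← Set.ncard_coe_finset]
    congr 1
    ext j
    exact hu.2 j
  have hsub : {C : Fin M → InnerCode p F n | ∃ u ∈ N, u ≠ 0 ∧ encode b C u = v} ⊆
      ⋃ u ∈ (U \ {0}).toFinset, {C | encode b C u = v} := by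
    rintro C ⟨u, hu, hu0, rfl⟩
    simp only [Set.mem_iUnion]
    refine ⟨u, ?_, rfl⟩
    rw [Set.mem_toFinset]
    refine ⟨⟨hu, fun j => ?_⟩, hu0⟩
    rw [hW, Finset.mem_filter_univ, ← not_iff_not, not_not, ← encode_apply_eq_zero_iff b C]
    push Not
    rfl
  refine (MeasureTheory.measureReal_mono hsub (MeasureTheory.measure_ne_top _ _)).trans
    ((MeasureTheory.measureReal_biUnion_finset_le _ _).trans ?_)
  rcases (U \ {0}).eq_empty_or_nonempty with hemp | ⟨u, hu, hu0⟩
  · rw [Finset.sum_eq_zero]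
    · positivity
    · intro u hu
      rw [Set.mem_toFinset, hemp] at hu
      exact hu.elim
  have heW : e < W.card := by
    have h := hC u hu.1 0 h0 hu0
    rwa [hammingDist_eq_weight_sub, sub_zero, hweight u hu] at h
  have hUcard : (((U \ {0}).toFinset.card : ℕ) : ℝ) ≤ r ^ (W.card - e) := by
    have h1 := ncard_support_eq_le hC W heW.le
    have h2 : (U \ {0}).toFinset.card ≤ (Fintype.card (L × L) - 1) ^ (W.card - e) := by
      rw [← Set.ncard_eq_toFinset_card']
      exact (Set.ncard_le_ncard Set.sdiff_subset (Set.toFinite _)).trans h1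
    have h3 : ((Fintype.card (L × L) - 1 : ℕ) : ℝ) = r := by
      have h4 : Fintype.card (L × L) = Fintype.card F ^ (2 * n) := by
        rw [Fintype.card_prod, card_eq_of_basis b, two_mul, pow_add]
      rw [h4, Nat.cast_sub (by omega), Nat.cast_pow, Nat.cast_one]
    rw [← h3]
    exact_mod_cast h2
  calc ∑ u ∈ (U \ {0}).toFinset, (innerLaw p F n M).real {C | encode b C u = v}
      ≤ ∑ u ∈ (U \ {0}).toFinset, (r⁻¹) ^ W.card := by
        refine Finset.sum_le_sum fun u hu => ?_
        rw [Set.mem_toFinset] at hu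
        rw [← hweight u hu.1]
        exact innerLaw_encode_eq_le b hF u v
    _ = (U \ {0}).toFinset.card * (r⁻¹) ^ W.card := by
        rw [Finset.sum_const, nsmul_eq_mul]
    _ ≤ r ^ (W.card - e) * (r⁻¹) ^ W.card := by
        gcongr
    _ = (r⁻¹) ^ e := by
        have h5 : W.card = W.card - e + e := by omega
        conv_lhs => rw [h5, Nat.add_sub_cancel, pow_add, ← mul_assoc, ← mul_pow,
          mul_inv_cancel₀ (by linarith), one_pow, one_mul]

theorem innerLaw_exists_weight_le (hF : 2 ≤ Fintype.card F ^ (2 * n))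
    {N : Set (Pauli L (Fin M))} {e : ℕ} (h0 : 0 ∈ N) (he : e < minDist N) (τ : ℝ) :
    (innerLaw p F n M).real {C | ∃ u ∈ N, u ≠ 0 ∧ (weight (encode b C u) : ℝ) ≤ τ} ≤
      ({v : Pauli F (Fin M × Fin n) | (weight v : ℝ) ≤ τ}.ncard : ℝ) *
        (((Fintype.card F : ℝ) ^ (2 * n) - 1)⁻¹) ^ e := by
  classical
  have hsub : {C : Fin M → InnerCode p F n |
      ∃ u ∈ N, u ≠ 0 ∧ (weight (encode b C u) : ℝ) ≤ τ} ⊆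
      ⋃ v ∈ {v : Pauli F (Fin M × Fin n) | (weight v : ℝ) ≤ τ}.toFinset,
        {C | ∃ u ∈ N, u ≠ 0 ∧ encode b C u = v} := by
    rintro C ⟨u, hu, hu0, hw⟩
    simp only [Set.mem_iUnion]
    exact ⟨encode b C u, Set.mem_toFinset.2 hw, u, hu, hu0, rfl⟩
  refine (MeasureTheory.measureReal_mono hsub (MeasureTheory.measure_ne_top _ _)).trans
    ((MeasureTheory.measureReal_biUnion_finset_le _ _).trans ?_)
  rw [Set.ncard_eq_toFinset_card', ← nsmul_eq_mul]
  exact Finset.sum_le_card_nsmul _ _ _ fun v _ => innerLaw_exists_encode_eq_le b hF h0 he v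

/-- By Bernoulli, `(1 - 1/T)^e ≥ 1 - e/T ≥ 1/2`; replacing `q^(2n) - 1` by `q^(2n)` thus costs only
a factor `2`. -/
theorem inv_sub_one_pow_le {T : ℝ} (hT : 2 ≤ T) {e : ℕ} (he : 2 * (e : ℝ) ≤ T) :
    ((T - 1)⁻¹) ^ e ≤ 2 * (T ^ e)⁻¹ := by
  have hT0 : 0 < T := by linarith
  have h1 : T⁻¹ ≤ 1 := inv_le_one_of_one_le₀ (by linarith)
  have h2 := one_add_mul_le_pow (a := -T⁻¹) (by linarith) e
  have h3 : (e : ℝ) * T⁻¹ ≤ 1 / 2 := by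
    rw [← div_eq_mul_inv, div_le_div_iff₀ hT0 two_pos]
    linarith
  have h4 : (T - 1) ^ e = T ^ e * (1 + -T⁻¹) ^ e := by
    rw [← mul_pow, mul_add, mul_one, mul_neg, mul_inv_cancel₀ hT0.ne', sub_eq_add_neg]
  have h5 : 1 / 2 ≤ (1 + -T⁻¹) ^ e := by linarith
  have h6 : 0 < T ^ e := by positivity
  rw [inv_pow, h4, mul_inv, mul_comm]
  refine mul_le_mul_of_nonneg_right ?_ (by positivity)
  calc ((1 + -T⁻¹) ^ e)⁻¹ ≤ (1 / 2)⁻¹ := inv_anti₀ (by norm_num) h5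
    _ = 2 := by norm_num

variable [Algebra (ZMod p) L]

/-- The probability that the relative distance of the concatenated code falls below `x`. -/
theorem innerLaw_distance_lt_le {q : ℕ} (hq : Fintype.card F = q) (hn : 0 < n) {K : ℕ}
    (hK : K ≤ q ^ n) {S : Set (Pauli L (Fin (q ^ n)))} (hS : IsQuantumMDS p S K) {x : ℝ}
    (hx : 0 < x) (hx1 : x ≤ 1 - 1 / ((q ^ 2 : ℕ) : ℝ)) :
    (innerLaw p F n (q ^ n)).real
        {C | (distance p (concatStabilizer b S C) : ℝ) / (n * (q : ℝ) ^ n) < x} ≤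
      2 * Real.exp (n * (q : ℝ) ^ n * (2 * Real.log q) *
        (entropy (q ^ 2) x - (1 - K / (q : ℝ) ^ n) / 2)) := by
  have hq2 : 2 ≤ q := hq ▸ Fintype.one_lt_card
  have hqr : (2 : ℝ) ≤ q := by exact_mod_cast hq2
  have hN : 0 < q ^ n := by positivity
  have : Nonempty (Fin (q ^ n)) := ⟨⟨0, hN⟩⟩
  have hD := minDist_normalizer hS (by simpa using hK)
  rw [Fintype.card_fin] at hD
  obtain ⟨e, he⟩ : ∃ e, minDist (normalizer p S) = e + 1 :=
    ⟨minDist (normalizer p S) - 1, by omega⟩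
  have he2 : 2 * e + K = q ^ n := by omega
  have hF : 2 ≤ Fintype.card F ^ (2 * n) := by
    rw [hq]
    exact hq2.trans (Nat.le_self_pow (by omega) q)
  have h0S : (0 : Pauli L (Fin (q ^ n))) ∈ S := by
    obtain ⟨⟨G, rfl⟩, -⟩ := hS.1
    exact G.zero_mem
  have h0N : (0 : Pauli L (Fin (q ^ n))) ∈ normalizer p S := by
    rw [mem_normalizer_iff]
    intro v _
    rw [map_zero, LinearMap.zero_apply, map_zero]
  have hd : distance p S ≠ 0 := by
    have := hS.2.1
    rw [Fintype.card_fin] at this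
    omega
  have hκ : (Fintype.card (Fin (q ^ n) × Fin n) : ℝ) = n * (q : ℝ) ^ n := by
    rw [Fintype.card_prod, Fintype.card_fin, Fintype.card_fin]
    push_cast
    ring
  have hnN : (0 : ℝ) < n * (q : ℝ) ^ n := by positivity
  have hsub : {C : Fin (q ^ n) → InnerCode p F n |
      (distance p (concatStabilizer b S C) : ℝ) / (n * (q : ℝ) ^ n) < x} ⊆
      {C | ∃ u ∈ normalizer p S, u ≠ 0 ∧ (weight (encode b C u) : ℝ) ≤
        x * Fintype.card (Fin (q ^ n) × Fin n)} := by
    intro C hC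
    obtain ⟨u, hu, hu0, hw⟩ := exists_weight_eq_distance b h0S hd C
    refine ⟨u, hu, hu0, ?_⟩
    rw [hw, hκ]
    exact ((div_lt_iff₀ hnN).1 hC).le
  refine (MeasureTheory.measureReal_mono hsub (MeasureTheory.measure_ne_top _ _)).trans
    ((innerLaw_exists_weight_le b hF h0N (e := e) (by omega) _).trans ?_)
  have hball := ncard_weight_le (F := F) (κ := Fin (q ^ n) × Fin n) x hx (by rwa [hq])
  rw [hκ, hq] at hball
  rw [hκ, hq]
  have hT : (2 : ℝ) ≤ (q : ℝ) ^ (2 * n) := by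
    rw [hq] at hF
    exact_mod_cast hF
  have heT : 2 * (e : ℝ) ≤ (q : ℝ) ^ (2 * n) := by
    have : 2 * e ≤ q ^ (2 * n) := by
      have := Nat.pow_le_pow_right (by omega : 0 < q) (by omega : n ≤ 2 * n)
      omega
    exact_mod_cast this
  have hr := inv_sub_one_pow_le hT heT
  have hlog : 0 < Real.log q := Real.log_pos (by linarith)
  have hexp : (((q : ℝ) ^ (2 * n)) ^ e)⁻¹ = Real.exp (-(2 * n * e * Real.log q)) := by
    rw [Real.exp_neg, ← pow_mul, ← Real.rpow_natCast, Real.rpow_def_of_pos (by linarith)]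
    congr 2
    push_cast
    ring
  refine (mul_le_mul hball hr (pow_nonneg (inv_nonneg.2 (by linarith)) _)
    (Real.exp_pos _).le).trans_eq ?_
  rw [hexp, mul_left_comm, ← Real.exp_add]
  congr 2
  have he2' : 2 * (e : ℝ) + K = (q : ℝ) ^ n := by exact_mod_cast he2
  have hKe : (1 - K / (q : ℝ) ^ n) / 2 = e / (q : ℝ) ^ n := by
    rw [← he2']
    have : 2 * (e : ℝ) + K ≠ 0 := by
      rw [he2']
      positivity
    field_simp
    ring
  -- The entropy has base `q²`, whence the factor `log q² = 2 log q`.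
  rw [hKe, entropy, Nat.cast_pow, Real.log_pow]
  have hqn : (q : ℝ) ^ n ≠ 0 := by positivity
  push_cast
  field_simp
  ring

theorem one_sub_le_innerLaw_of_fail_le {P : (Fin M → InnerCode p F n) → ℝ} {x a : ℝ}
    (h : (innerLaw p F n M).real {C | P C < x} ≤ a) :
    1 - a ≤ (innerLaw p F n M).real {C | P C ≥ x} := by
  have hu : (Set.univ : Set (Fin M → InnerCode p F n)) = {C | P C ≥ x} ∪ {C | P C < x} := by
    ext C
    simpa using le_or_gt x (P C)
  have h1 := MeasureTheory.measureReal_union_le (μ := innerLaw p F n M) {C | P C ≥ x} {C | P C < x}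
  rw [← hu, MeasureTheory.probReal_univ] at h1
  linarith

theorem innerLaw_eq_one_of_nonpos {P : (Fin M → InnerCode p F n) → ℝ} (hP : ∀ C, 0 ≤ P C) {x : ℝ}
    (hx : x ≤ 0) : (innerLaw p F n M).real {C | P C ≥ x} = 1 := by
  have : {C | P C ≥ x} = Set.univ := Set.eq_univ_of_forall fun C => hx.trans (hP C)
  rw [this, MeasureTheory.probReal_univ]

end UnionBound

/-! ### The distance bound at a given rate and its asymptotic form -/

section Main

variable {p : ℕ} [Fact p.Prime] {F : Type*} [Field F] [Fintype F] [Algebra (ZMod p) F] {q : ℕ}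
  {n : ℕ} {L : Type*} [Field L] [Fintype L] [Algebra (ZMod p) L] [Algebra F L]
  (b : Module.Basis (Fin n) F L)

theorem one_sub_rpow_le_innerLaw_distance (hq : Fintype.card F = q) (hn : 0 < n) {R : ℝ} {K : ℕ}
    (hR : R ∈ Set.Icc (0 : ℝ) 1) (hRK : (q : ℝ) ^ n * R = K) {S : Set (Pauli L (Fin (q ^ n)))}
    (hS : IsQuantumMDS p S K) :
    1 - (q : ℝ) ^ ((n : ℝ) - (1 - R) * (q : ℝ) ^ n * fbar q) ≤
      (innerLaw p F n (q ^ n)).real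
        {C | (distance p (concatStabilizer b S C) : ℝ) / (n * (q : ℝ) ^ n) ≥
          entropyInv (q ^ 2) ((1 - R) / 2) - 4 * fbar q / (n * (1 - R))} := by
  have hq2 : 2 ≤ q := hq ▸ Fintype.one_lt_card
  have hqr : (2 : ℝ) ≤ q := by exact_mod_cast hq2
  have hQ : 2 ≤ q ^ 2 := by nlinarith
  have hn1 : (1 : ℝ) ≤ n := by exact_mod_cast hn
  have hqn : (0 : ℝ) < (q : ℝ) ^ n := by positivity
  have hK : K ≤ q ^ n := by
    have : (K : ℝ) ≤ (q : ℝ) ^ n := by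
      rw [← hRK]
      exact mul_le_of_le_one_right hqn.le hR.2
    exact_mod_cast this
  have hf := fbar_nonneg hq2
  -- For `R = 1` the claimed probability bound is `1 - q^n ≤ 0`.
  rcases hR.2.eq_or_lt with rfl | hR1
  · refine le_trans ?_ MeasureTheory.measureReal_nonneg
    rw [sub_self, zero_mul, zero_mul, sub_zero, sub_nonpos]
    exact Real.one_le_rpow (by linarith) (by linarith)
  have hR1' : 0 < 1 - R := by linarith
  have hy : (1 - R) / 2 ∈ Set.Icc (0 : ℝ) 1 := ⟨by linarith, by linarith [hR.1]⟩
  have hm := entropyInv_mem hQ hy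
  have hE := entropy_entropyInv hQ hy
  set y := entropyInv (q ^ 2) ((1 - R) / 2)
  set x := y - 4 * fbar q / (n * (1 - R)) with hxdef
  rcases le_or_gt x 0 with hx | hx
  · rw [innerLaw_eq_one_of_nonpos (fun C => by positivity) hx, sub_le_self_iff]
    positivity
  apply one_sub_le_innerLaw_of_fail_le
  have hxy : x ≤ y := by
    rw [hxdef, sub_le_self_iff]
    positivity
  refine (innerLaw_distance_lt_le b hq hn hK hS hx (hxy.trans hm.2)).trans ?_
  -- The slope bound applies since the entropy at `y` is `(1 - R)/2 ≤ 1/2`.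
  have hslope := half_sub_le_entropy_sub hQ hx.le hxy hm.2 (by linarith [hR.1])
  rw [hE] at hslope
  have hKR : (K : ℝ) / (q : ℝ) ^ n = R := by
    rw [← hRK, mul_div_cancel_left₀ _ hqn.ne']
  have hlog : 0 < Real.log q := Real.log_pos (by linarith)
  have h2 : (2 : ℝ) ≤ Real.exp (n * Real.log q) := by
    rw [mul_comm, ← Real.rpow_def_of_pos (by linarith), Real.rpow_natCast]
    exact hqr.trans (le_self_pow₀ (by linarith) hn.ne')
  rw [hKR, Real.rpow_def_of_pos (by linarith)]
  calc 2 * Real.exp (n * (q : ℝ) ^ n * (2 * Real.log q) * (entropy (q ^ 2) x - (1 - R) / 2))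
      ≤ Real.exp (n * Real.log q) * Real.exp (n * (q : ℝ) ^ n * (2 * Real.log q) *
          (entropy (q ^ 2) x - (1 - R) / 2)) :=
        mul_le_mul_of_nonneg_right h2 (Real.exp_pos _).le
    _ ≤ _ := by
      rw [← Real.exp_add, Real.exp_le_exp]
      have h3 : entropy (q ^ 2) x - (1 - R) / 2 ≤ -(2 * fbar q / (n * (1 - R))) := by
        have : y - x = 2 * (2 * fbar q / (n * (1 - R))) := by
          rw [hxdef]
          ring
        linarith
      have h4 := mul_le_mul_of_nonneg_left h3
        (by positivity : 0 ≤ n * (q : ℝ) ^ n * (2 * Real.log q))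
      have h5 : n * (q : ℝ) ^ n * (2 * Real.log q) * -(2 * fbar q / (n * (1 - R))) =
          -((q : ℝ) ^ n * Real.log q * fbar q * (4 / (1 - R))) := by
        field_simp
        ring
      -- The exponent gained, `4/(1 - R)` times `q^n fbar q`, exceeds the `1 - R` times it that is
      -- required; the prefactor `2` was absorbed in `q^n`.
      have h6 : 1 - R ≤ 4 / (1 - R) := by
        rw [le_div_iff₀ hR1']
        nlinarith [hR.1]
      have h7 := mul_le_mul_of_nonneg_left h6
        (by positivity : 0 ≤ (q : ℝ) ^ n * Real.log q * fbar q)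
      have h8 : Real.log q * (n - (1 - R) * (q : ℝ) ^ n * fbar q) =
          n * Real.log q - (q : ℝ) ^ n * Real.log q * fbar q * (1 - R) := by
        ring
      rw [h8]
      linarith

theorem exists_one_sub_le_innerLaw_distance (hq : Fintype.card F = q) {R : ℝ}
    (hR : R ∈ Set.Icc (0 : ℝ) 1) {ε : ℝ} (hε : 0 < ε) {η : ℝ} (hη : 0 < η) :
    ∃ δ > (0 : ℝ), ∃ n₀ : ℕ, ∀ n ≥ n₀,
      ∀ (L : Type*) [Field L] [Fintype L] [Algebra (ZMod p) L] [Algebra F L]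
        (b : Module.Basis (Fin n) F L) (K : ℕ),
        K ≤ q ^ n → |(K : ℝ) / (q : ℝ) ^ n - R| < δ →
        ∀ S : Set (Pauli L (Fin (q ^ n))), IsQuantumMDS p S K →
          1 - η ≤ (innerLaw p F n (q ^ n)).real
            {C | (distance p (concatStabilizer b S C) : ℝ) / (n * (q : ℝ) ^ n) ≥
              entropyInv (q ^ 2) ((1 - R) / 2) - ε} := by
  have hq2 : 2 ≤ q := hq ▸ Fintype.one_lt_card
  have hqr : (2 : ℝ) ≤ q := by exact_mod_cast hq2
  have hQ : 2 ≤ q ^ 2 := by nlinarith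
  have hy : (1 - R) / 2 ∈ Set.Icc (0 : ℝ) 1 := ⟨by linarith [hR.2], by linarith [hR.1]⟩
  have hm := entropyInv_mem hQ hy
  have hE := entropy_entropyInv hQ hy
  set y := entropyInv (q ^ 2) ((1 - R) / 2)
  rcases le_or_gt (y - ε) 0 with hx | hx
  · refine ⟨1, one_pos, 0, fun n _ L _ _ _ _ b K _ _ S _ => ?_⟩
    rw [innerLaw_eq_one_of_nonpos (fun C => by positivity) hx]
    linarith
  have hxy : y - ε < y := by linarith
  have hgap := entropy_strictMonoOn hQ ⟨hx.le, by linarith [hm.2]⟩ hm hxy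
  rw [hE] at hgap
  set γ := (1 - R) / 2 - entropy (q ^ 2) (y - ε) with hγ
  have hγ0 : 0 < γ := by linarith
  have hlog2 : 1 ≤ 2 * Real.log q := by
    have h1 := Real.log_le_log two_pos hqr
    have h2 := Real.log_two_gt_d9
    linarith
  -- With `δ = γ`, the error in the rate uses up at most half of the gap `γ`. The remaining `γ/2`
  -- makes the exponential at most `η/2`, and `n₀ + 1` also ensures `n > 0`.
  obtain ⟨n₀, hn₀⟩ := exists_nat_gt (-Real.log (η / 2) / (γ / 2))
  refine ⟨γ, hγ0, n₀ + 1, fun n hn L _ _ _ _ b K hK hKR S hS => ?_⟩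
  apply one_sub_le_innerLaw_of_fail_le
  refine (innerLaw_distance_lt_le b hq (by omega) hK hS hx (by linarith [hm.2])).trans ?_
  have hrate : entropy (q ^ 2) (y - ε) - (1 - K / (q : ℝ) ^ n) / 2 ≤ -(γ / 2) := by
    have := (abs_lt.1 hKR).2
    linarith
  have hqn : (1 : ℝ) ≤ (q : ℝ) ^ n := one_le_pow₀ (by linarith)
  have hnn : (n₀ : ℝ) ≤ n := by exact_mod_cast (by omega : n₀ ≤ n)
  have hbig : (n : ℝ) ≤ n * (q : ℝ) ^ n * (2 * Real.log q) := by
    have h1 : (n : ℝ) ≤ n * (q : ℝ) ^ n := le_mul_of_one_le_right (Nat.cast_nonneg n) hqn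
    exact h1.trans (le_mul_of_one_le_right (by positivity) hlog2)
  have hexp : n * (q : ℝ) ^ n * (2 * Real.log q) *
      (entropy (q ^ 2) (y - ε) - (1 - K / (q : ℝ) ^ n) / 2) ≤ Real.log (η / 2) := by
    have h1 := mul_le_mul_of_nonneg_left hrate ((Nat.cast_nonneg n).trans hbig)
    have h2 := mul_le_mul_of_nonneg_right hbig (by linarith : 0 ≤ γ / 2)
    have h3 := hn₀.trans_le hnn
    rw [div_lt_iff₀ (by linarith)] at h3
    linarith
  have h4 := Real.exp_le_exp.2 hexp
  rw [Real.exp_log (by linarith)] at h4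
  linarith

end Main

end QConcat

end

theorem theorem2 (p : ℕ) [Fact p.Prime] (F : Type*) [Field F] [Fintype F]
    [Algebra (ZMod p) F] (q : ℕ) (hq : Fintype.card F = q) :
    (∀ n : ℕ, 2 ≤ n →
      ∀ (L : Type*) [Field L] [Fintype L] [Algebra (ZMod p) L] [Algebra F L]
        (b : Module.Basis (Fin n) F L) (R : ℝ) (K : ℕ),
        R ∈ Set.Icc (0 : ℝ) 1 → (q : ℝ) ^ n * R = K → Even ((K : ℤ) - q) →
        (∀ α : Fin (q ^ n) ≃ L, IsQuantumMDS p (rsStabilizer α ((q ^ n - K) / 2)) K) ∧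
        ∀ S : Set (Pauli L (Fin (q ^ n))), IsQuantumMDS p S K →
          (∀ C : Fin (q ^ n) → InnerCode p F n,
            IsStabilizer p (concatStabilizer b S C) (n * q ^ n - n * K)) ∧
          1 - (q : ℝ) ^ ((n : ℝ) - (1 - R) * (q : ℝ) ^ n * fbar q) ≤
            (innerLaw p F n (q ^ n)).real
              {C | (distance p (concatStabilizer b S C) : ℝ) / (n * (q : ℝ) ^ n) ≥
                entropyInv (q ^ 2) ((1 - R) / 2) - 4 * fbar q / (n * (1 - R))}) ∧
    (∀ R ∈ Set.Icc (0 : ℝ) 1, ∀ ε > (0 : ℝ), ∀ η > (0 : ℝ), ∃ δ > (0 : ℝ), ∃ n₀ : ℕ, ∀ n ≥ n₀,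
      ∀ (L : Type*) [Field L] [Fintype L] [Algebra (ZMod p) L] [Algebra F L]
        (b : Module.Basis (Fin n) F L) (K : ℕ),
        K ≤ q ^ n → Even ((K : ℤ) - q) → |(K : ℝ) / (q : ℝ) ^ n - R| < δ →
        ∀ S : Set (Pauli L (Fin (q ^ n))), IsQuantumMDS p S K →
          1 - η ≤ (innerLaw p F n (q ^ n)).real
            {C | (distance p (concatStabilizer b S C) : ℝ) / (n * (q : ℝ) ^ n) ≥
              entropyInv (q ^ 2) ((1 - R) / 2) - ε}) := by
  have hq2 : 2 ≤ q := hq ▸ Fintype.one_lt_card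
  refine ⟨fun n hn L _ _ _ _ b R K hR hRK hKq => ?_, fun R hR ε hε η hη => ?_⟩
  · have hK : K ≤ q ^ n := by
      have : (K : ℝ) ≤ (q : ℝ) ^ n := by
        rw [← hRK]
        exact mul_le_of_le_one_right (by positivity) hR.2
      exact_mod_cast this
    refine ⟨fun α => isQuantumMDS_rsStabilizer p α ?_, fun S hS => ⟨fun C => ?_, ?_⟩⟩
    · have h1 : Even (q ^ n - K) := by
        rw [Nat.even_sub hK, Nat.even_pow' (by omega)]
        rw [Int.even_sub, Int.even_coe_nat, Int.even_coe_nat] at hKq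
        exact hKq.symm
      rw [Fintype.card_fin, Nat.two_mul_div_two_of_even h1]
      omega
    · rw [← Nat.mul_sub]
      have h := hS.1
      rw [Fintype.card_fin] at h
      exact isStabilizer_concatStabilizer b h C
    · exact one_sub_rpow_le_innerLaw_distance b hq (by omega) hR hRK hS
  · obtain ⟨δ, hδ, n₀, h⟩ := exists_one_sub_le_innerLaw_distance (p := p) hq hR hε hη
    exact ⟨δ, hδ, n₀, fun n hn L _ _ _ _ b K hK _ hKR S hS => h n hn L b K hK hKR S hS⟩
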